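/- **Setting.** Let $K$ be the number of receivers and let all alphabets below be finite. Let $(X,Y_1,\dots,Y_K)$ have a fixed joint law, let $p_{Z|X}$ be a test channel (so $(Y_1,\dots,Y_K)-X-Z$), let $P_S$, $p_{T|S}$, $p_{U|TS}$ be fixed laws and let $p_{V_1\cdots V_K|US}$ be a memoryless broadcast channel, so that $(S,T,U,V_1,\dots,V_K)$ has law $P_S\,p_{T|S}\,p_{U|TS}\,p_{V_1\cdots V_K|US}$ and $T-(U,S)-(V_1,\dots,V_K)$. Logarithms are to base 2. For a law $P_A$ on a finite alphabet $\mathcal A$ put $$\mathcal T^n_\delta(A)=\Big\{a^n:\ \Big|\tfrac{N(a|a^n)}{n}-P_A(a)\Big|\le\delta P_A(a)\ \ \forall a\in\mathcal A\Big\},$$ where $N(a|a^n)$ is the number of occurrences of $a$ in $a^n$; for pairs, the same definition is used with the joint law. **The scheme (CDS with DPC)** with parameters $\delta,\delta',\delta'',\eta>0$, block lengths $n,m$ and sizes $M,M'\ge1$. Words $z^n(i)$, $1\le i\le M$, are drawn uniformly from $\mathcal T_\delta^n(Z)$ and words $t^m(i,j)$, $1\le i\le M$, $1\le j\le M'$,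 uniformly from $\mathcal T_\delta^m(T)$, all independently. The source and side information $(X^n,Y_1^n,\dots,Y_K^n)$ are i.i.d. The channel state information $S^m$, known non-causally to the encoder only, takes values in $\mathcal T_\eta^m(S)$; its law on this set is arbitrary and may depend on $X^n$ (given $X^n$, it is independent of the side information and of the codebooks). The encoder takes for $(i^*,j^*)$ the first pair $(i,j)$ in lexicographic order with $(X^n,z^n(i))\in\mathcal T_{\delta'}^n(X,Z)$ and $(S^m,t^m(i,j))\in\mathcal T_{\delta'}^m(S,T)$, and declares an error if there is none. Otherwise it sends $U^m$ drawn from $\prod_{l=1}^m p_{U|TS}(\cdot\,|\,t_l(i^*,j^*),S_l)$ over the channel. Receiver $k$ decides on the first pair $(\hat\imath_k,\hat\jmath_k)$ with $(Y_k^n,z^n(\hat\imath_k))\in\mathcal T_{\delta''}^n(Y_k,Z)$ and $(V_k^m,t^m(\hat\imath_k,\hat\jmath_k))\in\mathcal T_{\delta''}^m(V_k,T)$, and on $(1,1)$ if there is none. **Statement.** Let $\kappa>0$ be rational and suppose that $$I(X;Z|Y_k)<\kappa\,[\,I(T;V_k)-I(T;S)\,],\qquad k=1,\dots,K$$ (in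 particular $I(T;V_k)>I(S;T)$). Then in the scheme above every receiver decodes, together with $z^n(i^*)$, also the auxiliary codeword $t^m(i^*,j^*)$ with high probability. Precisely: for every sufficiently small $\gamma>0$ there is $\Delta>0$ such that for all $\delta,\delta',\delta'',\eta$ with $0<\delta<\Delta$, $0<\delta'<\delta''<\Delta$, $0<\eta<\min\{\delta,\delta'\}$ and all $\varepsilon>0$ there is $n_0$ such that for all $n>n_0$, $m=\kappa n$, all integers $M,M'\ge1$ with $$2^{n[I(X;Z)+\gamma]}\le M\le 2^{n[I(X;Z)+2\gamma]},\qquad 2^{m[I(S;T)+\gamma]}\le M'\le 2^{m[I(S;T)+2\gamma]},$$ and every admissible law of $S^m$ given $X^n$, $$\Pr\big[\text{the encoder finds }(i^*,j^*)\text{ and }(\hat\imath_k,\hat\jmath_k)=(i^*,j^*)\text{ for all }k=1,\dots,K\big]>1-\varepsilon ,$$ where the probability is over the codebooks, the source and side information, the CSI, the channel input and the channel. -/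

import Mathlib

namespace CDSDPC

noncomputable section

/-! Finite probability and information measures. A probability mass function on a finite type `Ω`
is an element of `stdSimplex ℝ Ω`; random variables are maps out of `Ω`. -/

open Classical in
/-- The law (distribution) of the random variable `f` under the mass function `p`. -/
def law {Ω A : Type*} [Fintype Ω] (p : Ω → ℝ) (f : Ω → A) (a : A) : ℝ :=
  ∑ ω with f ω = a, p ω

/-- Mutual information `I(f; g)` in bits. -/
def mutualInfo {Ω A B : Type*} [Fintype Ω] [Fintype A] [Fintype B]
    (p : Ω → ℝ) (f : Ω → A) (g : Ω → B) : ℝ :=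
  ∑ a, ∑ b, law p (fun ω => (f ω, g ω)) (a, b) *
    Real.logb 2 (law p (fun ω => (f ω, g ω)) (a, b) / (law p f a * law p g b))

/-- Conditional mutual information `I(f; g | h)` in bits. -/
def condMutualInfo {Ω A B C : Type*} [Fintype Ω] [Fintype A] [Fintype B] [Fintype C]
    (p : Ω → ℝ) (f : Ω → A) (g : Ω → B) (h : Ω → C) : ℝ :=
  ∑ a, ∑ b, ∑ c, law p (fun ω => (f ω, g ω, h ω)) (a, b, c) *
    Real.logb 2 (law p (fun ω => (f ω, g ω, h ω)) (a, b, c) * law p h c /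
      (law p (fun ω => (f ω, h ω)) (a, c) * law p (fun ω => (g ω, h ω)) (b, c)))

/-- `N(a | w)`: the number of times the letter `a` appears in the word `w`. -/
def letterCount {A : Type*} {n : ℕ} (a : A) (w : Fin n → A) : ℕ :=
  Nat.card {l : Fin n // w l = a}

open Classical in
/-- The typical set `T_δ^n(P)`: words `w` of length `n` with
`|N(a | w) / n - P(a)| ≤ δ P(a)` for every letter `a`. -/
def typicalSet {A : Type*} [Fintype A] (δ : ℝ) (n : ℕ) (P : A → ℝ) : Finset (Fin n → A) :=
  Finset.univ.filter fun w => ∀ a, |(letterCount a w : ℝ) / n - P a| ≤ δ * P a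

/-- Two words of the same length, read as one word of pairs. -/
def zipWord {A B : Type*} {n : ℕ} (a : Fin n → A) (b : Fin n → B) : Fin n → A × B :=
  fun l => (a l, b l)

/-- The single-letter data for `K` receivers: the joint law of the source and the side information,
the test channel `p(z | x)`, the law of the channel state information (CSI), the conditional laws
`p(t | s)` and `p(u | t, s)`, and the broadcast channel `p(v_1, …, v_K | u, s)`. -/
structure Model (K : ℕ) (X : Type*) (Y : Fin K → Type*) (Z S T U : Type*) (V : Fin K → Type*)
    [Fintype X] [∀ k, Fintype (Y k)] [Fintype Z] [Fintype S] [Fintype T] [Fintype U]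
    [∀ k, Fintype (V k)] where
  pXY : X × (∀ k, Y k) → ℝ
  pXY_mem : pXY ∈ stdSimplex ℝ (X × (∀ k, Y k))
  pZ : X → Z → ℝ
  pZ_mem : ∀ x, pZ x ∈ stdSimplex ℝ Z
  pS : S → ℝ
  pS_mem : pS ∈ stdSimplex ℝ S
  pT : S → T → ℝ
  pT_mem : ∀ s, pT s ∈ stdSimplex ℝ T
  pU : T → S → U → ℝ
  pU_mem : ∀ t s, pU t s ∈ stdSimplex ℝ U
  pV : U → S → (∀ k, V k) → ℝ
  pV_mem : ∀ u s, pV u s ∈ stdSimplex ℝ (∀ k, V k)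

namespace Model

variable {K : ℕ} {X : Type*} {Y : Fin K → Type*} {Z S T U : Type*} {V : Fin K → Type*}
  [Fintype X] [∀ k, Fintype (Y k)] [Fintype Z] [Fintype S] [Fintype T] [Fintype U]
  [∀ k, Fintype (V k)]

/-- Joint law of `(X, Y_1, …, Y_K, Z)`; it satisfies the Markov condition
`(Y_1, …, Y_K) - X - Z`. -/
def srcLaw (P : Model K X Y Z S T U V) : X × (∀ k, Y k) × Z → ℝ :=
  fun ω => P.pXY (ω.1, ω.2.1) * P.pZ ω.1 ω.2.2

/-- Joint law of `(S, T, U, V_1, …, V_K)`; it satisfies the Markov condition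
`T - (U, S) - (V_1, …, V_K)`. -/
def chLaw (P : Model K X Y Z S T U V) : S × T × U × (∀ k, V k) → ℝ :=
  fun ω => P.pS ω.1 * P.pT ω.1 ω.2.1 * P.pU ω.2.1 ω.1 ω.2.2.1 * P.pV ω.2.2.1 ω.1 ω.2.2.2

/-- `I(X; Z)`. -/
def infoXZ (P : Model K X Y Z S T U V) : ℝ :=
  mutualInfo P.srcLaw (fun ω => ω.1) (fun ω => ω.2.2)

/-- `I(X; Z | Y_k)`. -/
def infoXZgivenY (P : Model K X Y Z S T U V) (k : Fin K) : ℝ :=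
  condMutualInfo P.srcLaw (fun ω => ω.1) (fun ω => ω.2.2) (fun ω => ω.2.1 k)

/-- `I(S; T)`. -/
def infoST (P : Model K X Y Z S T U V) : ℝ :=
  mutualInfo P.chLaw (fun ω => ω.1) (fun ω => ω.2.1)

/-- `I(T; V_k)`. -/
def infoTV (P : Model K X Y Z S T U V) (k : Fin K) : ℝ :=
  mutualInfo P.chLaw (fun ω => ω.2.1) (fun ω => ω.2.2.2 k)

/-- `T_δ^n(Z)`. -/
def typZ (P : Model K X Y Z S T U V) (δ : ℝ) (n : ℕ) : Finset (Fin n → Z) :=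
  typicalSet δ n (law P.srcLaw fun ω => ω.2.2)

/-- `T_δ^n(X, Z)`. -/
def typXZ (P : Model K X Y Z S T U V) (δ : ℝ) (n : ℕ) : Finset (Fin n → X × Z) :=
  typicalSet δ n (law P.srcLaw fun ω => (ω.1, ω.2.2))

/-- `T_δ^n(Y_k, Z)`. -/
def typYZ (P : Model K X Y Z S T U V) (k : Fin K) (δ : ℝ) (n : ℕ) : Finset (Fin n → Y k × Z) :=
  typicalSet δ n (law P.srcLaw fun ω => (ω.2.1 k, ω.2.2))

/-- `T_δ^m(S)`. -/
def typS (P : Model K X Y Z S T U V) (δ : ℝ) (m : ℕ) : Finset (Fin m → S) :=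
  typicalSet δ m P.pS

/-- `T_δ^m(T)`. -/
def typT (P : Model K X Y Z S T U V) (δ : ℝ) (m : ℕ) : Finset (Fin m → T) :=
  typicalSet δ m (law P.chLaw fun ω => ω.2.1)

/-- `T_δ^m(S, T)`. -/
def typST (P : Model K X Y Z S T U V) (δ : ℝ) (m : ℕ) : Finset (Fin m → S × T) :=
  typicalSet δ m (law P.chLaw fun ω => (ω.1, ω.2.1))

/-- `T_δ^m(V_k, T)`. -/
def typVT (P : Model K X Y Z S T U V) (k : Fin K) (δ : ℝ) (m : ℕ) : Finset (Fin m → V k × T) :=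
  typicalSet δ m (law P.chLaw fun ω => (ω.2.2.2 k, ω.2.1))

end Model

open Classical in
/-- The first pair `(i, j)`, in lexicographic order, that satisfies `Q`; `none` if there is none. -/
def firstPair {M M' : ℕ} (Q : Fin M → Fin M' → Prop) : Option (Fin M × Fin M') :=
  (List.finRange M ×ˢ List.finRange M').find? fun p => decide (Q p.1 p.2)

section Scheme

variable {K : ℕ} {X : Type*} {Y : Fin K → Type*} {Z S T U : Type*} {V : Fin K → Type*}
  [Fintype X] [∀ k, Fintype (Y k)] [Fintype Z] [Fintype S] [Fintype T] [Fintype U]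
  [∀ k, Fintype (V k)] {n m M M' : ℕ}

/-- The pair `(i*, j*)` found by the encoder for the codebooks `z`, `t`, the source word `x` and the
CSI `s`; `none` means that the encoder declares an error. -/
def encoderPair (P : Model K X Y Z S T U V) (δ' : ℝ)
    (z : Fin M → Fin n → Z) (t : Fin M → Fin M' → Fin m → T) (x : Fin n → X) (s : Fin m → S) :
    Option (Fin M × Fin M') :=
  firstPair fun i j => zipWord x (z i) ∈ P.typXZ δ' n ∧ zipWord s (t i j) ∈ P.typST δ' m

/-- The pair decided by receiver `k` from its side information `y` and its channel output `v`:
the first pair that passes both typicality tests, and the very first pair if there is none. -/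
def decoderPair [NeZero M] [NeZero M'] (P : Model K X Y Z S T U V) (δ'' : ℝ)
    (z : Fin M → Fin n → Z) (t : Fin M → Fin M' → Fin m → T)
    (k : Fin K) (y : Fin n → Y k) (v : Fin m → V k) : Fin M × Fin M' :=
  (firstPair fun i j => zipWord y (z i) ∈ P.typYZ k δ'' n ∧
    zipWord v (t i j) ∈ P.typVT k δ'' m).getD (0, 0)

open Classical in
/-- For given codebooks, source word `x`, side information `y` and CSI `s`: the probability, over
the channel input drawn from `∏ p(u_l | t_l(i*, j*), s_l)` and the memoryless channel, that the
encoder finds a pair `(i*, j*)` and that every receiver decides on this pair. -/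
def channelSuccess [NeZero M] [NeZero M'] (P : Model K X Y Z S T U V) (δ' δ'' : ℝ)
    (z : Fin M → Fin n → Z) (t : Fin M → Fin M' → Fin m → T)
    (x : Fin n → X) (y : Fin n → ∀ k, Y k) (s : Fin m → S) : ℝ :=
  match encoderPair P δ' z t x s with
  | none => 0
  | some p =>
    ∑ u : Fin m → U, ∑ v : Fin m → ∀ k, V k,
      (∏ l, P.pU (t p.1 p.2 l) (s l) (u l)) * (∏ l, P.pV (u l) (s l) (v l)) *
        if ∀ k, decoderPair P δ'' z t k (fun l => y l k) (fun l => v l k) = p then 1 else 0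

/-- The success probability for given codebooks, averaged over the i.i.d. pairs of source and side
information and over the CSI, which is drawn from `q x` when the source word is `x`. -/
def codeSuccess [NeZero M] [NeZero M'] (P : Model K X Y Z S T U V) (δ' δ'' : ℝ)
    (q : (Fin n → X) → (Fin m → S) → ℝ)
    (z : Fin M → Fin n → Z) (t : Fin M → Fin M' → Fin m → T) : ℝ :=
  ∑ x : Fin n → X, ∑ y : Fin n → ∀ k, Y k, ∑ s : Fin m → S,
    (∏ l, P.pXY (x l, y l)) * q x s * channelSuccess P δ' δ'' z t x y s

open Classical in
/-- The codebooks `(z, t)` of which all words `z i` lie in `T_δ^n(Z)` and all words `t i j` in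
`T_δ^m(T)`. -/
def codebooks (P : Model K X Y Z S T U V) (δ : ℝ) (n m M M' : ℕ) :
    Finset ((Fin M → Fin n → Z) × (Fin M → Fin M' → Fin m → T)) :=
  (Fintype.piFinset fun _ => P.typZ δ n) ×ˢ
    (Fintype.piFinset fun _ => Fintype.piFinset fun _ => P.typT δ m)

/-- The probability of success of the random coding scheme: all codewords are drawn independently
and uniformly from their typical sets, so the codebooks are uniform on `codebooks`. -/
def schemeSuccess (P : Model K X Y Z S T U V) (δ δ' δ'' : ℝ) (n m M M' : ℕ)
    [NeZero M] [NeZero M'] (q : (Fin n → X) → (Fin m → S) → ℝ) : ℝ :=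
  (∑ c ∈ codebooks P δ n m M M', codeSuccess P δ' δ'' q c.1 c.2) /
    (codebooks P δ n m M M').card

end Scheme

end

end CDSDPC

/-! The argument is random coding with a fixed typical source word `x` and a fixed typical CSI word
`s`. Given these, the side information is drawn from a kernel p(y|x) and, once t is chosen, the
outputs from a kernel p(v|s,t), independently of each other and of the remaining codewords. A bound
uniform over typical `x` and `s` then survives averaging against any CSI law supported on typical
words, however it depends on `x`; atypical source words have vanishing probability.

The encoder fails rarely because the codebook rates exceed I(X;Z) and I(S;T)
(`eventually_covering_le_count`, `sum_codes_firstPair_none_le`). The chosen pair passes the tests of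
the receivers by the conditional typicality lemma `probOf_not_typical_le`, since δ' < δ''. Wrong
pairs are of two kinds. In another row both words are fresh, and the union bound gives about M M'
2^(-n I(Y_k;Z) - m I(T;V_k)). By the Markov identity I(X;Z|Y_k) = I(X;Z) - I(Y_k;Z), the rate
condition makes this vanish. In the chosen row only the t-word is fresh, and the bound is about M'
2^(-m I(T;V_k)). It vanishes because I(X;Z|Y_k) ≥ 0 forces I(S;T) < I(T;V_k); this is why the
auxiliary codeword is decoded as well.

The delicate point is that the chosen pair depends on the whole codebook. If it avoids a given row
(or column), it is also the first pair of a search that ignores that row (or column). The ignored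
words can then be redrawn without affecting the search (`sum_get_le_of_resample`), and the packing
bound `eventually_count_le_packing` applies to them. `le_sum_pairSuccess` collects all the error
terms. -/

namespace CDSDPC

open scoped Classical

/-! ### Laws of random variables and probabilities of events. -/

section Law

variable {Ω A B : Type*} [Fintype Ω]

theorem law_eq_sum_ite (p : Ω → ℝ) (f : Ω → A) (a : A) :
    law p f a = ∑ ω, if f ω = a then p ω else 0 := by
  unfold law
  rw [Finset.sum_filter]

/-- Turns sums over values into expectations over `Ω`, so that identities between information
quantities can be checked pointwise in ω. -/
theorem sum_law_mul [Fintype A] (p : Ω → ℝ) (f : Ω → A) (g : A → ℝ) :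
    ∑ a, law p f a * g a = ∑ ω, p ω * g (f ω) := by
  simp_rw [law_eq_sum_ite, Finset.sum_mul]
  rw [Finset.sum_comm]
  refine Finset.sum_congr rfl fun ω _ => ?_
  simp [ite_mul]

theorem law_nonneg {p : Ω → ℝ} (hp : ∀ ω, 0 ≤ p ω) (f : Ω → A) (a : A) : 0 ≤ law p f a :=
  Finset.sum_nonneg fun ω _ => hp ω

theorem law_mem_stdSimplex [Fintype A] {p : Ω → ℝ} (hp : p ∈ stdSimplex ℝ Ω) (f : Ω → A) :
    law p f ∈ stdSimplex ℝ A := by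
  refine ⟨law_nonneg hp.1 f, ?_⟩
  have := sum_law_mul p f fun _ => 1
  simpa [hp.2] using this

/-- At a point of positive mass every marginal is positive, which legitimizes splitting logarithms
there; points of mass zero contribute nothing. -/
theorem le_law {p : Ω → ℝ} (hp : ∀ ω, 0 ≤ p ω) (f : Ω → A) (ω : Ω) : p ω ≤ law p f (f ω) := by
  unfold law
  exact Finset.single_le_sum (f := p) (fun ω _ => hp ω) (by simp)

theorem law_law [Fintype A] (p : Ω → ℝ) (f : Ω → A) (g : A → B) :
    law (law p f) g = law p fun ω => g (f ω) := by
  funext b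
  have := sum_law_mul p f fun a => if g a = b then 1 else 0
  simpa [law_eq_sum_ite] using this

theorem sum_law_prodMk_left [Fintype A] (p : Ω → ℝ) (f : Ω → A) (g : Ω → B) (b : B) :
    ∑ a, law p (fun ω => (f ω, g ω)) (a, b) = law p g b := by
  simp_rw [law_eq_sum_ite]
  rw [Finset.sum_comm]
  refine Finset.sum_congr rfl fun ω _ => ?_
  by_cases h : g ω = b <;> simp [h]

end Law

section Prob

variable {Ω : Type*} [Fintype Ω]

/-- The probability of the event `E` under the mass function `p`. -/
noncomputable def probOf (p : Ω → ℝ) (E : Ω → Prop) : ℝ :=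
  ∑ ω with E ω, p ω

theorem probOf_eq_sum_ite (p : Ω → ℝ) (E : Ω → Prop) [DecidablePred E] :
    probOf p E = ∑ ω, if E ω then p ω else 0 := by
  rw [probOf, Finset.sum_filter]
  congr! 2

theorem probOf_nonneg {p : Ω → ℝ} (hp : ∀ ω, 0 ≤ p ω) (E : Ω → Prop) : 0 ≤ probOf p E :=
  Finset.sum_nonneg fun ω _ => hp ω

theorem probOf_mono {p : Ω → ℝ} (hp : ∀ ω, 0 ≤ p ω) {E F : Ω → Prop} (h : ∀ ω, E ω → F ω) :
    probOf p E ≤ probOf p F :=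
  Finset.sum_le_sum_of_subset_of_nonneg
    (fun ω hω => Finset.mem_filter.2 ⟨Finset.mem_univ _, h ω (Finset.mem_filter.1 hω).2⟩)
    fun ω _ _ => hp ω

theorem probOf_exists_le {ι : Type*} [Fintype ι] {p : Ω → ℝ} (hp : ∀ ω, 0 ≤ p ω)
    (E : ι → Ω → Prop) : probOf p (fun ω => ∃ i, E i ω) ≤ ∑ i, probOf p (E i) := by
  simp_rw [probOf_eq_sum_ite]
  rw [Finset.sum_comm]
  refine Finset.sum_le_sum fun ω _ => ?_
  have h0 : ∀ i ∈ Finset.univ, 0 ≤ if E i ω then p ω else 0 := by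
    intro i _
    split_ifs
    exacts [hp ω, le_rfl]
  split_ifs with h
  · obtain ⟨i, hi⟩ := h
    refine le_trans ?_ (Finset.single_le_sum h0 (Finset.mem_univ i))
    simp [hi]
  · exact Finset.sum_nonneg h0

theorem probOf_add_probOf_not (p : Ω → ℝ) (E : Ω → Prop) :
    probOf p E + probOf p (fun ω => ¬ E ω) = ∑ ω, p ω := by
  rw [probOf_eq_sum_ite, probOf_eq_sum_ite, ← Finset.sum_add_distrib]
  refine Finset.sum_congr rfl fun ω _ => ?_
  by_cases h : E ω <;> simp [h]

theorem probOf_le_one {p : Ω → ℝ} (hp : p ∈ stdSimplex ℝ Ω) (E : Ω → Prop) : probOf p E ≤ 1 := by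
  have h1 := probOf_add_probOf_not p E
  have h2 := probOf_nonneg hp.1 fun ω => ¬ E ω
  rw [hp.2] at h1
  linarith

end Prob

/-! ### Typical words. -/

section Words

variable {A B : Type*} [Fintype A] [Fintype B] {n : ℕ}

theorem letterCount_eq_sum {A : Type*} (a : A) (w : Fin n → A) :
    (letterCount a w : ℝ) = ∑ l, if w l = a then 1 else 0 := by
  rw [letterCount, Nat.card_eq_fintype_card, Fintype.card_subtype, Finset.sum_boole]

theorem sum_letterCount_mul (w : Fin n → A) (g : A → ℝ) :
    ∑ a, (letterCount a w : ℝ) * g a = ∑ l, g (w l) := by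
  simp_rw [letterCount_eq_sum, Finset.sum_mul]
  rw [Finset.sum_comm]
  refine Finset.sum_congr rfl fun l _ => ?_
  simp [ite_mul]

theorem mem_typicalSet {δ : ℝ} {p : A → ℝ} {w : Fin n → A} :
    w ∈ typicalSet δ n p ↔ ∀ a, |(letterCount a w : ℝ) / n - p a| ≤ δ * p a := by
  simp [typicalSet]

theorem typicalSet_mono {δ δ' : ℝ} (h : δ ≤ δ') {p : A → ℝ} (hp : ∀ a, 0 ≤ p a) :
    typicalSet δ n p ⊆ typicalSet δ' n p := by
  intro w hw
  rw [mem_typicalSet] at hw ⊢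
  exact fun a => (hw a).trans (mul_le_mul_of_nonneg_right h (hp a))

/-- A letterwise image of a typical word is typical for the image law. -/
theorem map_mem_typicalSet {δ : ℝ} {p : A → ℝ} {w : Fin n → A} (hw : w ∈ typicalSet δ n p)
    (f : A → B) : (fun l => f (w l)) ∈ typicalSet δ n (law p f) := by
  rw [mem_typicalSet] at hw ⊢
  intro b
  have h1 : (letterCount b (fun l => f (w l)) : ℝ) =
      ∑ a with f a = b, (letterCount a w : ℝ) := by
    rw [letterCount_eq_sum, Finset.sum_filter]
    rw [← sum_letterCount_mul w fun a => if f a = b then 1 else 0]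
    simp
  have h2 : law p f b = ∑ a with f a = b, p a := by
    rw [law_eq_sum_ite, Finset.sum_filter]
  rw [h1, h2, Finset.sum_div, ← Finset.sum_sub_distrib, Finset.mul_sum]
  -- The tolerance is proportional to the letter probability, so the tolerances over a fibre add up
  -- to the tolerance for the image letter, with the same δ.
  exact (Finset.abs_sum_le_sum_abs _ _).trans (Finset.sum_le_sum fun a _ => hw a)

/-- The tolerance of a letter of probability zero is zero, so it cannot occur in a typical word. -/
theorem pos_of_mem_typicalSet {δ : ℝ} {p : A → ℝ} (hp : ∀ a, 0 ≤ p a) {w : Fin n → A}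
    (hw : w ∈ typicalSet δ n p) (l : Fin n) : 0 < p (w l) := by
  refine (hp _).lt_of_ne fun h => ?_
  have h1 := mem_typicalSet.1 hw (w l)
  rw [← h, mul_zero, sub_zero, abs_nonpos_iff, div_eq_zero_iff] at h1
  have hn : (n : ℝ) ≠ 0 := by
    have := l.pos
    positivity
  have h2 : (letterCount (w l) w : ℝ) = 0 := by tauto
  rw [letterCount_eq_sum] at h2
  have h3 := (Finset.sum_eq_zero_iff_of_nonneg (fun i _ => by positivity)).1 h2 l (Finset.mem_univ _)
  simp at h3

/-- The typical average lemma. -/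
theorem abs_sum_sub_le_of_mem_typicalSet {δ : ℝ} {p : A → ℝ} {w : Fin n → A}
    (hw : w ∈ typicalSet δ n p) (g : A → ℝ) :
    |∑ l, g (w l) - n * ∑ a, p a * g a| ≤ n * (δ * ∑ a, p a * |g a|) := by
  rcases Nat.eq_zero_or_pos n with rfl | hn
  · simp
  have hn' : (0 : ℝ) < n := by exact_mod_cast hn
  have h1 : ∑ l, g (w l) - n * ∑ a, p a * g a =
      n * ∑ a, ((letterCount a w : ℝ) / n - p a) * g a := by
    rw [← sum_letterCount_mul, Finset.mul_sum, Finset.mul_sum, ← Finset.sum_sub_distrib]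
    refine Finset.sum_congr rfl fun a _ => ?_
    field_simp
  rw [h1, abs_mul, abs_of_pos hn']
  refine mul_le_mul_of_nonneg_left ?_ hn'.le
  rw [Finset.mul_sum]
  refine (Finset.abs_sum_le_sum_abs _ _).trans (Finset.sum_le_sum fun a _ => ?_)
  rw [abs_mul, ← mul_assoc]
  exact mul_le_mul_of_nonneg_right (mem_typicalSet.1 hw a) (abs_nonneg _)

end Words

/-! ### Product measures, Chebyshev's inequality and conditional typicality. -/

section Product

variable {B : Type*} [Fintype B] {n : ℕ}

theorem sum_prod_words {R : Type*} [CommSemiring R] (f : Fin n → B → R) :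
    ∑ b : Fin n → B, ∏ l, f l (b l) = ∏ l, ∑ b, f l b := by
  rw [Finset.prod_univ_sum, Fintype.piFinset_univ]

theorem prod_words_mem_stdSimplex {W : Fin n → B → ℝ} (hW : ∀ l, W l ∈ stdSimplex ℝ B) :
    (fun b : Fin n → B => ∏ l, W l (b l)) ∈ stdSimplex ℝ (Fin n → B) := by
  refine ⟨fun b => Finset.prod_nonneg fun l _ => (hW l).1 _, ?_⟩
  rw [sum_prod_words]
  exact Finset.prod_eq_one fun l _ => (hW l).2

/-- Independent variables, one of them centred, are uncorrelated. The factors `if l = i` and `if l =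
j` spread the product over all coordinates, so the sum factors and its `i`-th factor is the
vanishing mean. -/
theorem sum_prod_mul_mul_eq_zero {W : Fin n → B → ℝ} {φ : Fin n → B → ℝ}
    {i j : Fin n} (hij : i ≠ j) (hφ : ∑ b, W i b * φ i b = 0) :
    ∑ b : Fin n → B, (∏ l, W l (b l)) * (φ i (b i) * φ j (b j)) = 0 := by
  have h : ∀ b : Fin n → B, (∏ l, W l (b l)) * (φ i (b i) * φ j (b j)) =
      ∏ l, W l (b l) * ((if l = i then φ l (b l) else 1) * (if l = j then φ l (b l) else 1)) := by
    intro b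
    rw [Finset.prod_mul_distrib, Finset.prod_mul_distrib]
    simp
  simp_rw [h]
  rw [sum_prod_words fun l b =>
    W l b * ((if l = i then φ l b else 1) * (if l = j then φ l b else 1))]
  refine Finset.prod_eq_zero (Finset.mem_univ i) ?_
  simpa [hij] using hφ

/-- Chebyshev's inequality for sums of independent `[0, 1]`-valued variables. -/
theorem probOf_deviation_le {W : Fin n → B → ℝ} (hW : ∀ l, W l ∈ stdSimplex ℝ B)
    {f : Fin n → B → ℝ} (hf0 : ∀ l b, 0 ≤ f l b) (hf1 : ∀ l b, f l b ≤ 1)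
    (hn : 0 < n) {θ : ℝ} (hθ : 0 < θ) :
    probOf (fun b : Fin n → B => ∏ l, W l (b l))
      (fun b => n * θ < |∑ l, f l (b l) - ∑ l, ∑ c, W l c * f l c|) ≤
      (n : ℝ)⁻¹ * (θ ^ 2)⁻¹ := by
  have hn' : (0 : ℝ) < n := by exact_mod_cast hn
  set φ : Fin n → B → ℝ := fun l b => f l b - ∑ c, W l c * f l c with hφ
  have hWp := prod_words_mem_stdSimplex hW
  have hmean : ∀ l, ∑ b, W l b * φ l b = 0 := by
    intro l
    simp only [hφ, mul_sub, Finset.sum_sub_distrib]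
    rw [← Finset.sum_mul, (hW l).2, one_mul, sub_self]
  have hφ1 : ∀ l b, φ l b * φ l b ≤ 1 := by
    intro l b
    have h0 : 0 ≤ ∑ c, W l c * f l c :=
      Finset.sum_nonneg fun c _ => mul_nonneg ((hW l).1 c) (hf0 l c)
    have h1 : ∑ c, W l c * f l c ≤ 1 := by
      rw [← (hW l).2]
      exact Finset.sum_le_sum fun c _ => mul_le_of_le_one_right ((hW l).1 c) (hf1 l c)
    have := hf0 l b
    have := hf1 l b
    simp only [hφ]
    rw [← abs_le_one_iff_mul_self_le_one, abs_le]
    constructor <;> linarith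
  have hdev : ∀ b : Fin n → B,
      ∑ l, f l (b l) - ∑ l, ∑ c, W l c * f l c = ∑ l, φ l (b l) := by
    intro b
    simp only [hφ, Finset.sum_sub_distrib]
  -- In the second moment only the n diagonal terms remain, each at most 1.
  have hsecond : ∑ b : Fin n → B, (∏ l, W l (b l)) * (∑ l, φ l (b l)) ^ 2 ≤ n := by
    have h1 : ∑ b : Fin n → B, (∏ l, W l (b l)) * (∑ l, φ l (b l)) ^ 2 =
        ∑ i, ∑ j, ∑ b : Fin n → B, (∏ l, W l (b l)) * (φ i (b i) * φ j (b j)) := by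
      simp_rw [pow_two, Finset.sum_mul_sum, Finset.mul_sum]
      rw [Finset.sum_comm]
      exact Finset.sum_congr rfl fun i _ => Finset.sum_comm
    rw [h1]
    have h2 : ∀ i, ∑ j, ∑ b : Fin n → B, (∏ l, W l (b l)) * (φ i (b i) * φ j (b j)) ≤ 1 := by
      intro i
      rw [Finset.sum_eq_single i (fun j _ hj => sum_prod_mul_mul_eq_zero hj.symm (hmean i))
        (by simp)]
      rw [← hWp.2]
      exact Finset.sum_le_sum fun b _ => mul_le_of_le_one_right (hWp.1 b) (hφ1 _ _)
    refine (Finset.sum_le_sum fun i _ => h2 i).trans ?_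
    simp
  unfold probOf
  simp_rw [hdev]
  have hmark : (n * θ) ^ 2 * ∑ b : Fin n → B with n * θ < |∑ l, φ l (b l)|, ∏ l, W l (b l) ≤
      n := by
    refine le_trans ?_ hsecond
    rw [Finset.mul_sum]
    refine (Finset.sum_le_sum fun b hb => ?_).trans
      (Finset.sum_le_sum_of_subset_of_nonneg (Finset.filter_subset _ _)
        fun b _ _ => mul_nonneg (hWp.1 b) (sq_nonneg _))
    rw [mul_comm]
    refine mul_le_mul_of_nonneg_left ?_ (hWp.1 b)
    rw [← sq_abs (∑ l, φ l (b l))]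
    exact pow_le_pow_left₀ (by positivity) (Finset.mem_filter.1 hb).2.le 2
  rw [← mul_inv, ← one_div, le_div_iff₀ (by positivity)]
  have h3 : (n : ℝ) * ((∑ b : Fin n → B with n * θ < |∑ l, φ l (b l)|, ∏ l, W l (b l)) *
      (n * θ ^ 2)) ≤ n * 1 := by
    calc _ = (n * θ) ^ 2 * ∑ b : Fin n → B with n * θ < |∑ l, φ l (b l)|, ∏ l, W l (b l) := by
          ring
      _ ≤ _ := by simpa using hmark
  exact le_of_mul_le_mul_left h3 hn'

end Product

section ConditionalTypicality

variable {A B : Type*} [Fintype A] [Fintype B]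

/-- The conditional typicality lemma. -/
theorem probOf_not_typical_le {n : ℕ} {p : A → ℝ} (hp : ∀ a, 0 ≤ p a) {W : A → B → ℝ}
    (hW : ∀ a, W a ∈ stdSimplex ℝ B) {δ₁ δ₂ : ℝ} (hδ : δ₁ < δ₂) (hn : 0 < n)
    {w : Fin n → A} (hw : w ∈ typicalSet δ₁ n p) :
    probOf (fun b : Fin n → B => ∏ l, W (w l) (b l))
      (fun b => zipWord w b ∉ typicalSet δ₂ n fun c => p c.1 * W c.1 c.2) ≤
      (n : ℝ)⁻¹ * ∑ c : A × B, (((δ₂ - δ₁) * (p c.1 * W c.1 c.2)) ^ 2)⁻¹ := by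
  have hn' : (0 : ℝ) < n := by exact_mod_cast hn
  have hWp := prod_words_mem_stdSimplex fun l => hW (w l)
  refine (probOf_mono hWp.1 (F := fun b => ∃ c : A × B, δ₂ * (p c.1 * W c.1 c.2) <
    |(letterCount c (zipWord w b) : ℝ) / n - p c.1 * W c.1 c.2|) fun b hb => ?_).trans ?_
  · rw [mem_typicalSet] at hb
    push Not at hb
    exact hb
  refine (probOf_exists_le hWp.1 _).trans ?_
  rw [Finset.mul_sum]
  refine Finset.sum_le_sum fun c _ => ?_
  obtain ⟨a, b₀⟩ := c
  -- For a pair of probability zero the right-hand term is `0⁻¹ = 0`, so the event must have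
  -- probability exactly zero. If the pair occurs, `a` is a letter of the typical word `w`, so `p a
  -- > 0` and the kernel factor vanishes.
  rcases ((mul_nonneg (hp a) ((hW a).1 b₀)).eq_or_lt) with h0 | hpos
  · refine le_of_eq_of_le (Finset.sum_eq_zero fun b hb => ?_) (by positivity)
    · have hb := (Finset.mem_filter.1 hb).2
      simp only [← h0, mul_zero, sub_zero, abs_pos] at hb
      have hne : (letterCount (a, b₀) (zipWord w b) : ℝ) ≠ 0 := fun h => hb (by simp [h])
      rw [letterCount_eq_sum] at hne
      obtain ⟨l, -, hl⟩ := Finset.exists_ne_zero_of_sum_ne_zero hne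
      have hl' : w l = a ∧ b l = b₀ := by
        by_contra hcon
        exact hl (if_neg (by simpa [zipWord] using hcon))
      refine Finset.prod_eq_zero (Finset.mem_univ l) ?_
      have hpa := pos_of_mem_typicalSet hp hw l
      rw [hl'.1] at hpa
      rw [hl'.1, hl'.2]
      exact (mul_eq_zero.1 h0.symm).resolve_left hpa.ne'
  · refine le_trans ?_ (probOf_deviation_le (fun l => hW (w l))
      (f := fun l b => if w l = a ∧ b = b₀ then 1 else 0) (fun l b => by positivity)
      (fun l b => by split_ifs <;> norm_num) hn
      (mul_pos (sub_pos.2 hδ) hpos))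
    refine probOf_mono hWp.1 fun b hb => ?_
    have h1 : ∑ l, (if w l = a ∧ b l = b₀ then (1 : ℝ) else 0) =
        letterCount (a, b₀) (zipWord w b) := by
      rw [letterCount_eq_sum]
      simp [zipWord]
    have h2 : ∑ l, ∑ c, W (w l) c * (if w l = a ∧ c = b₀ then (1 : ℝ) else 0) =
        letterCount a w * W a b₀ := by
      rw [letterCount_eq_sum, Finset.sum_mul]
      refine Finset.sum_congr rfl fun l _ => ?_
      by_cases hl : w l = a <;> simp [hl]
    simp only at hb
    rw [h1, h2]
    set N : ℝ := (letterCount (a, b₀) (zipWord w b) : ℝ)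
    set N₀ : ℝ := (letterCount a w : ℝ)
    -- Typicality of `w` accounts for a deviation of at most δ₁ times the pair probability; the
    -- remaining δ₂ - δ₁ must come from the random letters.
    have h3 : |N₀ / n - p a| * W a b₀ ≤ δ₁ * p a * W a b₀ :=
      mul_le_mul_of_nonneg_right (mem_typicalSet.1 hw a) ((hW a).1 b₀)
    have h4 : N - N₀ * W a b₀ =
        n * ((N / n - p a * W a b₀) - (N₀ / n - p a) * W a b₀) := by
      field_simp
      ring
    rw [h4, abs_mul, abs_of_pos hn']
    refine mul_lt_mul_of_pos_left ?_ hn'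
    have h5 := abs_sub_abs_le_abs_sub (N / n - p a * W a b₀) ((N₀ / n - p a) * W a b₀)
    rw [abs_mul (N₀ / n - p a), abs_of_nonneg ((hW a).1 b₀)] at h5
    linarith

theorem eventually_forall_probOf_not_typical_le {p : A → ℝ} (hp : ∀ a, 0 ≤ p a) {W : A → B → ℝ}
    (hW : ∀ a, W a ∈ stdSimplex ℝ B) {δ₁ δ₂ : ℝ} (hδ : δ₁ < δ₂) {ε : ℝ} (hε : 0 < ε) :
    ∀ᶠ n : ℕ in Filter.atTop, ∀ w ∈ typicalSet δ₁ n p,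
      probOf (fun b : Fin n → B => ∏ l, W (w l) (b l))
        (fun b => zipWord w b ∉ typicalSet δ₂ n fun c => p c.1 * W c.1 c.2) ≤ ε := by
  have h1 : Filter.Tendsto (fun n : ℕ => (n : ℝ)⁻¹ *
      ∑ c : A × B, (((δ₂ - δ₁) * (p c.1 * W c.1 c.2)) ^ 2)⁻¹) Filter.atTop (nhds 0) := by
    simpa using tendsto_inv_atTop_nhds_zero_nat (𝕜 := ℝ) |>.mul_const
      (∑ c : A × B, (((δ₂ - δ₁) * (p c.1 * W c.1 c.2)) ^ 2)⁻¹)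
  filter_upwards [h1.eventually_le_const hε, Filter.eventually_gt_atTop 0] with n h2 hn w hw
  exact (probOf_not_typical_le hp hW hδ hn hw).trans h2

/-- The weak law: an i.i.d. word is typical with high probability. -/
theorem eventually_probOf_not_typical_le {p : B → ℝ} (hp : p ∈ stdSimplex ℝ B) {δ : ℝ}
    (hδ : 0 < δ) {ε : ℝ} (hε : 0 < ε) :
    ∀ᶠ n : ℕ in Filter.atTop,
      probOf (fun b : Fin n → B => ∏ l, p (b l)) (fun b => b ∉ typicalSet δ n p) ≤ ε := by
  -- Conditional typicality over a one-letter alphabet, whose only word is typical even with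
  -- tolerance 0.
  filter_upwards [eventually_forall_probOf_not_typical_le (p := fun _ : Unit => (1 : ℝ))
    (by simp) (W := fun _ => p) (fun _ => hp) hδ hε, Filter.eventually_gt_atTop 0] with n h hn
  refine le_trans ?_ (h (fun _ => ()) ?_)
  · refine probOf_mono (fun b => Finset.prod_nonneg fun l _ => hp.1 _) fun b hb hcon => hb ?_
    have h2 := map_mem_typicalSet hcon Prod.snd
    have h3 : law (fun c : Unit × B => 1 * p c.2) Prod.snd = p := by
      funext b
      rw [law_eq_sum_ite, Fintype.sum_prod_type]
      simp
    rwa [h3] at h2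
  · rw [mem_typicalSet]
    intro a
    have hn' : (n : ℝ) ≠ 0 := by positivity
    rw [letterCount_eq_sum]
    simp [hn']

end ConditionalTypicality

/-! ### Entropy and mutual information. -/

section Entropy

variable {Ω A B C : Type*} [Fintype Ω] [Fintype A] [Fintype B] [Fintype C]

/-- The entropy of a mass function, in bits. -/
noncomputable def entropy (p : A → ℝ) : ℝ :=
  -∑ a, p a * Real.logb 2 (p a)

theorem entropy_law (p : Ω → ℝ) (f : Ω → A) :
    entropy (law p f) = -∑ ω, p ω * Real.logb 2 (law p f (f ω)) := by
  rw [entropy, sum_law_mul p f fun a => Real.logb 2 (law p f a)]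

theorem mutualInfo_eq_entropy {p : Ω → ℝ} (hp : ∀ ω, 0 ≤ p ω) (f : Ω → A) (g : Ω → B) :
    mutualInfo p f g =
      entropy (law p f) + entropy (law p g) - entropy (law p fun ω => (f ω, g ω)) := by
  have h1 : mutualInfo p f g = ∑ ω, p ω * Real.logb 2 (law p (fun ω => (f ω, g ω)) (f ω, g ω) /
      (law p f (f ω) * law p g (g ω))) := by
    rw [mutualInfo, ← sum_law_mul p (fun ω => (f ω, g ω)) fun c =>
      Real.logb 2 (law p (fun ω => (f ω, g ω)) c / (law p f c.1 * law p g c.2)),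
      Fintype.sum_prod_type]
  rw [h1, entropy_law, entropy_law, entropy_law, ← Finset.sum_neg_distrib,
    ← Finset.sum_neg_distrib, ← Finset.sum_neg_distrib, ← Finset.sum_add_distrib,
    ← Finset.sum_sub_distrib]
  refine Finset.sum_congr rfl fun ω _ => ?_
  rcases (hp ω).eq_or_lt with h0 | hpos
  · simp [← h0]
  · have hf := hpos.trans_le (le_law hp f ω)
    have hg := hpos.trans_le (le_law hp g ω)
    have hfg := hpos.trans_le (le_law hp (fun ω => (f ω, g ω)) ω)
    rw [Real.logb_div hfg.ne' (by positivity), Real.logb_mul hf.ne' hg.ne']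
    ring

theorem condMutualInfo_eq_sum (p : Ω → ℝ) (f : Ω → A) (g : Ω → B) (h : Ω → C) :
    condMutualInfo p f g h = ∑ ω, p ω * Real.logb 2
      (law p (fun ω => (f ω, g ω, h ω)) (f ω, g ω, h ω) * law p h (h ω) /
      (law p (fun ω => (f ω, h ω)) (f ω, h ω) * law p (fun ω => (g ω, h ω)) (g ω, h ω))) := by
  rw [condMutualInfo, ← sum_law_mul p (fun ω => (f ω, g ω, h ω)) fun c =>
      Real.logb 2 (law p (fun ω => (f ω, g ω, h ω)) c * law p h c.2.2 /
      (law p (fun ω => (f ω, h ω)) (c.1, c.2.2) * law p (fun ω => (g ω, h ω)) (c.2.1, c.2.2))),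
      Fintype.sum_prod_type]
  simp_rw [Fintype.sum_prod_type]

/-- If `h - f - g` is a Markov chain then `I(f; g | h) = I(f; g) - I(h; g)`. -/
theorem condMutualInfo_of_markov {p : Ω → ℝ} (hp : ∀ ω, 0 ≤ p ω) (f : Ω → A) (g : Ω → B)
    (h : Ω → C)
    (hM : ∀ a b c, law p (fun ω => (f ω, g ω, h ω)) (a, b, c) * law p f a =
      law p (fun ω => (f ω, h ω)) (a, c) * law p (fun ω => (f ω, g ω)) (a, b)) :
    condMutualInfo p f g h = mutualInfo p f g - mutualInfo p h g := by
  rw [condMutualInfo_eq_sum, mutualInfo_eq_entropy hp, mutualInfo_eq_entropy hp, entropy_law,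
    entropy_law, entropy_law, entropy_law, entropy_law]
  simp only [← Finset.sum_neg_distrib, ← Finset.sum_add_distrib, ← Finset.sum_sub_distrib]
  refine Finset.sum_congr rfl fun ω _ => ?_
  rcases (hp ω).eq_or_lt with h0 | hpos
  · simp [← h0]
  have hf := hpos.trans_le (le_law hp f ω)
  have hh := hpos.trans_le (le_law hp h ω)
  have hfg := hpos.trans_le (le_law hp (fun ω => (f ω, g ω)) ω)
  have hfh := hpos.trans_le (le_law hp (fun ω => (f ω, h ω)) ω)
  have hgh := hpos.trans_le (le_law hp (fun ω => (g ω, h ω)) ω)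
  have hfgh := hpos.trans_le (le_law hp (fun ω => (f ω, g ω, h ω)) ω)
  have hsymm : law p (fun ω => (h ω, g ω)) (h ω, g ω) = law p (fun ω => (g ω, h ω)) (g ω, h ω) := by
    simp only [law_eq_sum_ite, Prod.mk.injEq, and_comm]
  have hM' := congrArg (Real.logb 2) (hM (f ω) (g ω) (h ω))
  rw [Real.logb_mul hfgh.ne' hf.ne', Real.logb_mul hfh.ne' hfg.ne'] at hM'
  rw [Real.logb_div (by positivity) (by positivity), Real.logb_mul hfgh.ne' hh.ne',
    Real.logb_mul hfh.ne' hgh.ne', hsymm]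
  linear_combination p ω * hM'

/-- This is a relative entropy between the joint law and q(a,b,c) = p(a,c) p(b,c) / p(c), bounded
below through 1 - 1/x ≤ log x. In the main proof it shows that I(T;V_k) - I(S;T) is positive. -/
theorem condMutualInfo_nonneg {p : Ω → ℝ} (hp : p ∈ stdSimplex ℝ Ω) (f : Ω → A) (g : Ω → B)
    (h : Ω → C) : 0 ≤ condMutualInfo p f g h := by
  set r := law p fun ω => (f ω, g ω, h ω) with hr
  set q : A × B × C → ℝ := fun c => law p (fun ω => (f ω, h ω)) (c.1, c.2.2) *
    law p (fun ω => (g ω, h ω)) (c.2.1, c.2.2) / law p h c.2.2 with hq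
  have hq0 : ∀ c, 0 ≤ q c := fun c => div_nonneg (mul_nonneg (law_nonneg hp.1 _ _)
    (law_nonneg hp.1 _ _)) (law_nonneg hp.1 _ _)
  have hqsum : ∑ c, q c = 1 := by
    simp only [hq]
    rw [Fintype.sum_prod_type, Finset.sum_congr rfl fun a _ => Fintype.sum_prod_type _]
    rw [Finset.sum_congr rfl fun a _ => Finset.sum_comm, Finset.sum_comm]
    rw [← (law_mem_stdSimplex hp h).2]
    refine Finset.sum_congr rfl fun c _ => ?_
    simp only [← Finset.sum_div, ← Finset.mul_sum, ← Finset.sum_mul]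
    rw [sum_law_prodMk_left, sum_law_prodMk_left]
    exact mul_self_div_self _
  have hr0 : ∀ c, 0 ≤ r c := law_nonneg hp.1 _
  have hsum : 0 ≤ ∑ ω, p ω * (1 - q (f ω, g ω, h ω) / r (f ω, g ω, h ω)) := by
    rw [← sum_law_mul p (fun ω => (f ω, g ω, h ω)) fun c => 1 - q c / r c]
    -- Only an inequality: where `r` vanishes, `q` may still be positive.
    have h1 : ∀ c, r c - q c ≤ r c * (1 - q c / r c) := by
      intro c
      rcases (hr0 c).eq_or_lt with h0 | hpos
      · rw [← h0]
        simpa using hq0 c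
      · rw [mul_sub, mul_div_cancel₀ _ hpos.ne', mul_one]
    calc (0 : ℝ) = ∑ c, (r c - q c) := by
          rw [Finset.sum_sub_distrib, hqsum, (law_mem_stdSimplex hp _).2, sub_self]
      _ ≤ _ := Finset.sum_le_sum fun c _ => h1 c
  have hlog : 0 < Real.log 2 := Real.log_pos one_lt_two
  have hmain : (∑ ω, p ω * (1 - q (f ω, g ω, h ω) / r (f ω, g ω, h ω))) / Real.log 2 ≤
      condMutualInfo p f g h := by
    rw [condMutualInfo_eq_sum, Finset.sum_div]
    refine Finset.sum_le_sum fun ω _ => ?_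
    rcases (hp.1 ω).eq_or_lt with h0 | hpos
    · simp [← h0]
    have hh := hpos.trans_le (le_law hp.1 h ω)
    have hfh := hpos.trans_le (le_law hp.1 (fun ω => (f ω, h ω)) ω)
    have hgh := hpos.trans_le (le_law hp.1 (fun ω => (g ω, h ω)) ω)
    have hfgh : 0 < r (f ω, g ω, h ω) := hpos.trans_le (le_law hp.1 (fun ω => (f ω, g ω, h ω)) ω)
    rw [mul_div_assoc, Real.logb]
    refine mul_le_mul_of_nonneg_left ?_ hpos.le
    refine div_le_div_of_nonneg_right ?_ hlog.le
    refine le_trans (le_of_eq ?_) (Real.one_sub_inv_le_log_of_pos (by positivity))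
    simp only [hq]
    rw [← hr]
    field_simp
  exact (div_nonneg hsum hlog.le).trans hmain

end Entropy

/-! ### Counting jointly typical words: packing and covering. -/

section Counting

variable {A B : Type*} [Fintype A] [Fintype B]

/-- Where the first marginal vanishes the conditional law is arbitrary; the second marginal serves
as a default. -/
theorem exists_kernel {r : A × B → ℝ} (hr : r ∈ stdSimplex ℝ (A × B)) :
    ∃ W : A → B → ℝ, (∀ a, W a ∈ stdSimplex ℝ B) ∧
      ∀ a b, r (a, b) = law r Prod.fst a * W a b := by
  have hfst : ∀ a, law r Prod.fst a = ∑ b, r (a, b) := by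
    intro a
    rw [law_eq_sum_ite, Fintype.sum_prod_type, Finset.sum_comm]
    simp
  refine ⟨fun a => if law r Prod.fst a = 0 then law r Prod.snd else
    fun b => r (a, b) / law r Prod.fst a, fun a => ?_, fun a b => ?_⟩
  · dsimp only
    split_ifs with h
    · exact law_mem_stdSimplex hr _
    · refine ⟨fun b => div_nonneg (hr.1 _) (law_nonneg hr.1 _ _), ?_⟩
      rw [← Finset.sum_div, ← hfst, div_self h]
  · dsimp only
    split_ifs with h
    · have := le_law hr.1 Prod.fst (a, b)
      rw [h] at this ⊢
      rw [zero_mul]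
      exact le_antisymm this (hr.1 _)
    · field_simp

theorem prod_eq_rpow_sum_logb {n : ℕ} {h : Fin n → ℝ} (hpos : ∀ l, 0 < h l) :
    ∏ l, h l = (2 : ℝ) ^ ∑ l, Real.logb 2 (h l) := by
  rw [Real.rpow_sum_of_pos two_pos]
  refine Finset.prod_congr rfl fun l _ => ?_
  rw [Real.rpow_logb two_pos (by norm_num) (hpos l)]

/-- Bounds on the probability of a typical word. -/
theorem prod_mem_Icc_of_mem_typicalSet {n : ℕ} {δ : ℝ} {r h : A → ℝ} (hr : ∀ a, 0 ≤ r a)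
    (hh : ∀ a, 0 < r a → 0 < h a ∧ h a ≤ 1) {w : Fin n → A} (hw : w ∈ typicalSet δ n r) :
    ∏ l, h (w l) ∈ Set.Icc ((2 : ℝ) ^ (-(n * ((1 + δ) * -∑ a, r a * Real.logb 2 (h a)))))
      ((2 : ℝ) ^ (-(n * ((1 - δ) * -∑ a, r a * Real.logb 2 (h a))))) := by
  have h1 := abs_le.1 (abs_sum_sub_le_of_mem_typicalSet hw fun a => Real.logb 2 (h a))
  -- Since `h ≤ 1` all logarithms have the same sign, so the error term is δ times the main term.
  have h2 : ∑ a, r a * |Real.logb 2 (h a)| = -∑ a, r a * Real.logb 2 (h a) := by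
    rw [← Finset.sum_neg_distrib]
    refine Finset.sum_congr rfl fun a _ => ?_
    rcases (hr a).eq_or_lt with h0 | hpos
    · simp [← h0]
    · rw [abs_of_nonpos (Real.logb_nonpos one_lt_two (hh a hpos).1.le (hh a hpos).2), mul_neg]
  rw [h2] at h1
  rw [prod_eq_rpow_sum_logb fun l => (hh _ (pos_of_mem_typicalSet hr hw l)).1]
  constructor <;> refine Real.rpow_le_rpow_of_exponent_le one_le_two ?_ <;> nlinarith [h1.1, h1.2]

/-- Cardinalities are written as `probOf` of the constant mass 1. This bound and the next convert
bounds on the mass of single words into bounds on the size of a set. -/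
theorem mul_count_le_one {Ω : Type*} [Fintype Ω] {p : Ω → ℝ} (hp : p ∈ stdSimplex ℝ Ω)
    {E : Ω → Prop} {c : ℝ} (hc : ∀ ω, E ω → c ≤ p ω) : c * probOf (fun _ => 1) E ≤ 1 := by
  refine le_trans ?_ (probOf_le_one hp E)
  unfold probOf
  rw [Finset.mul_sum]
  refine Finset.sum_le_sum fun ω hω => ?_
  simpa using hc ω (Finset.mem_filter.1 hω).2

theorem probOf_le_mul_count {Ω : Type*} [Fintype Ω] {p : Ω → ℝ}
    {E : Ω → Prop} {c : ℝ} (hc : ∀ ω, E ω → p ω ≤ c) : probOf p E ≤ c * probOf (fun _ => 1) E := by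
  unfold probOf
  rw [Finset.mul_sum]
  refine Finset.sum_le_sum fun ω hω => ?_
  simpa using hc ω (Finset.mem_filter.1 hω).2

theorem count_mem {Ω : Type*} [Fintype Ω] (S : Finset Ω) :
    probOf (fun _ => 1) (fun ω => ω ∈ S) = S.card := by
  simp [probOf]

/-- The chain rule: the exponent attached to the kernel is the conditional entropy H(B|A). -/
theorem sum_mul_logb_kernel {r : A × B → ℝ} (hr : r ∈ stdSimplex ℝ (A × B)) {W : A → B → ℝ}
    (hrW : ∀ a b, r (a, b) = law r Prod.fst a * W a b) :
    -∑ c, r c * Real.logb 2 (W c.1 c.2) = entropy r - entropy (law r Prod.fst) := by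
  rw [entropy_law, entropy, ← Finset.sum_neg_distrib, ← Finset.sum_neg_distrib,
    ← Finset.sum_neg_distrib, ← Finset.sum_sub_distrib]
  refine Finset.sum_congr rfl fun c _ => ?_
  rcases (hr.1 c).eq_or_lt with h0 | hpos
  · simp [← h0]
  · have h1 := hrW c.1 c.2
    have h2 : law r Prod.fst c.1 * W c.1 c.2 ≠ 0 := by
      rw [← h1]
      exact hpos.ne'
    have h3 := congrArg (Real.logb 2) h1
    rw [Real.logb_mul (left_ne_zero_of_mul h2) (right_ne_zero_of_mul h2)] at h3
    simp only [Prod.mk.eta] at h3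
    rw [h3]
    ring

theorem kernel_pos_le_one {r : A × B → ℝ} {W : A → B → ℝ}
    (hW : ∀ a, W a ∈ stdSimplex ℝ B) (hrW : ∀ a b, r (a, b) = law r Prod.fst a * W a b)
    (c : A × B) (hc : 0 < r c) : 0 < W c.1 c.2 ∧ W c.1 c.2 ≤ 1 := by
  constructor
  · refine ((hW c.1).1 c.2).lt_of_ne fun h => ?_
    have := hrW c.1 c.2
    rw [← h, mul_zero] at this
    exact hc.ne' this
  · rw [← (hW c.1).2]
    exact Finset.single_le_sum (f := W c.1) (fun b _ => (hW c.1).1 b) (Finset.mem_univ _)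

theorem le_one_of_mem_stdSimplex {p : A → ℝ} (hp : p ∈ stdSimplex ℝ A) (a : A) : p a ≤ 1 := by
  rw [← hp.2]
  exact Finset.single_le_sum (f := p) (fun b _ => hp.1 b) (Finset.mem_univ _)

theorem card_typicalSet_le {p : A → ℝ} (hp : p ∈ stdSimplex ℝ A) (δ : ℝ) (n : ℕ) :
    ((typicalSet δ n p).card : ℝ) ≤ (2 : ℝ) ^ (n * ((1 + δ) * entropy p)) := by
  have h1 := mul_count_le_one (prod_words_mem_stdSimplex fun _ : Fin n => hp)
    (E := fun w => w ∈ typicalSet δ n p)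
    fun w hw => (prod_mem_Icc_of_mem_typicalSet hp.1
      (fun a ha => ⟨ha, le_one_of_mem_stdSimplex hp a⟩) hw).1
  rw [count_mem, Real.rpow_neg two_pos.le] at h1
  rwa [inv_mul_le_iff₀ (by positivity), mul_one] at h1

/-- The typical set eventually carries mass at least 1/2, while each of its words has mass at most
2^(-n(1-δ)H). -/
theorem eventually_le_card_typicalSet {p : A → ℝ} (hp : p ∈ stdSimplex ℝ A) {δ : ℝ}
    (hδ : 0 < δ) : ∀ᶠ n : ℕ in Filter.atTop,
      2⁻¹ * (2 : ℝ) ^ (n * ((1 - δ) * entropy p)) ≤ (typicalSet δ n p).card := by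
  filter_upwards [eventually_probOf_not_typical_le hp hδ (ε := 2⁻¹) (by norm_num)] with n hn
  have hw := prod_words_mem_stdSimplex fun _ : Fin n => hp
  have h1 := probOf_add_probOf_not (fun w : Fin n → A => ∏ l, p (w l))
    fun w => w ∈ typicalSet δ n p
  rw [hw.2] at h1
  have h2 := probOf_le_mul_count (p := fun w : Fin n → A => ∏ l, p (w l))
    (E := fun w => w ∈ typicalSet δ n p)
    fun w hw => (prod_mem_Icc_of_mem_typicalSet hp.1
      (fun a ha => ⟨ha, le_one_of_mem_stdSimplex hp a⟩) hw).2
  rw [count_mem, Real.rpow_neg two_pos.le] at h2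
  rw [mul_comm, ← le_inv_mul_iff₀ (by positivity)]
  refine le_trans ?_ h2
  linarith

/-- Under the kernel applied along `w`, each counted word has mass at least 2^(-n(1+δ)H(B|A)). No
typicality of `w` is assumed, which suits an arbitrary received word. -/
theorem count_zipWord_typical_le {r : A × B → ℝ} (hr : r ∈ stdSimplex ℝ (A × B)) (δ : ℝ) {n : ℕ}
    (w : Fin n → A) :
    probOf (fun _ => 1) (fun b : Fin n → B => zipWord w b ∈ typicalSet δ n r) ≤
      (2 : ℝ) ^ (n * ((1 + δ) * (entropy r - entropy (law r Prod.fst)))) := by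
  obtain ⟨W, hW, hrW⟩ := exists_kernel hr
  have h1 := mul_count_le_one (prod_words_mem_stdSimplex fun l : Fin n => hW (w l))
    (E := fun b => zipWord w b ∈ typicalSet δ n r)
    fun b hb => (prod_mem_Icc_of_mem_typicalSet (h := fun c => W c.1 c.2) hr.1
      (kernel_pos_le_one hW hrW) hb).1
  rw [sum_mul_logb_kernel hr hrW, Real.rpow_neg two_pos.le] at h1
  rwa [inv_mul_le_iff₀ (by positivity), mul_one] at h1

theorem eventually_le_count_zipWord_typical {r : A × B → ℝ} (hr : r ∈ stdSimplex ℝ (A × B))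
    {δ₁ δ₂ : ℝ} (hδ : δ₁ < δ₂) : ∀ᶠ n : ℕ in Filter.atTop,
      ∀ w ∈ typicalSet δ₁ n (law r Prod.fst),
        2⁻¹ * (2 : ℝ) ^ (n * ((1 - δ₂) * (entropy r - entropy (law r Prod.fst)))) ≤
          probOf (fun _ => 1) (fun b : Fin n → B => zipWord w b ∈ typicalSet δ₂ n r) := by
  obtain ⟨W, hW, hrW⟩ := exists_kernel hr
  have hr' : (fun c : A × B => law r Prod.fst c.1 * W c.1 c.2) = r :=
    funext fun c => (hrW c.1 c.2).symm
  have hev := eventually_forall_probOf_not_typical_le (law_nonneg hr.1 Prod.fst) hW hδ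
    (ε := 2⁻¹) (by norm_num)
  rw [hr'] at hev
  filter_upwards [hev] with n hn w hw
  have hp := prod_words_mem_stdSimplex fun l : Fin n => hW (w l)
  have h1 := probOf_add_probOf_not (fun b : Fin n → B => ∏ l, W (w l) (b l))
    fun b => zipWord w b ∈ typicalSet δ₂ n r
  rw [hp.2] at h1
  have h2 := probOf_le_mul_count (p := fun b : Fin n → B => ∏ l, W (w l) (b l))
    (E := fun b => zipWord w b ∈ typicalSet δ₂ n r)
    fun b hb => (prod_mem_Icc_of_mem_typicalSet (h := fun c => W c.1 c.2) hr.1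
      (kernel_pos_le_one hW hrW) hb).2
  rw [sum_mul_logb_kernel hr hrW, Real.rpow_neg two_pos.le] at h2
  rw [mul_comm, ← le_inv_mul_iff₀ (by positivity)]
  refine le_trans ?_ h2
  have := hn w hw
  linarith

theorem eventually_le_rpow (L : ℝ) {c : ℝ} (hc : 0 < c) :
    ∀ᶠ n : ℕ in Filter.atTop, L ≤ (2 : ℝ) ^ ((n : ℝ) * c) := by
  have h : Filter.Tendsto (fun n : ℕ => (2 : ℝ) ^ ((n : ℝ) * c)) Filter.atTop Filter.atTop :=
    (tendsto_rpow_atTop_of_base_gt_one 2 one_lt_two).comp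
      (tendsto_natCast_atTop_atTop.atTop_mul_const hc)
  exact h.eventually_ge_atTop L

/-- Packing: a typical word drawn uniformly is jointly typical with a given word with probability
at most about `2 ^ (-n I)`. -/
theorem eventually_count_le_packing {r : A × B → ℝ} (hr : r ∈ stdSimplex ℝ (A × B))
    {δ δ₂ γ : ℝ} (hδ : 0 < δ)
    (hγ : δ * entropy (law r Prod.snd) + δ₂ * (entropy r - entropy (law r Prod.fst)) < γ) :
    ∀ᶠ n : ℕ in Filter.atTop, ∀ w : Fin n → A,
      probOf (fun _ => 1) (fun b : Fin n → B => b ∈ typicalSet δ n (law r Prod.snd) ∧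
        zipWord w b ∈ typicalSet δ₂ n r) ≤
      (2 : ℝ) ^ (-((n : ℝ) * (entropy (law r Prod.fst) + entropy (law r Prod.snd) - entropy r - γ)))
        * (typicalSet δ n (law r Prod.snd)).card := by
  filter_upwards [eventually_le_card_typicalSet (law_mem_stdSimplex hr Prod.snd) hδ,
    eventually_le_rpow 2 (sub_pos.2 hγ)] with n h1 h2 w
  refine (probOf_mono (fun _ => zero_le_one) fun b hb => hb.2).trans
    ((count_zipWord_typical_le hr δ₂ w).trans ?_)
  refine le_trans ?_ (mul_le_mul_of_nonneg_left h1 (by positivity))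
  -- The factor 2 is absorbed by the strict slack in `hγ`.
  rw [mul_left_comm ((2 : ℝ) ^ (-_)), ← div_eq_inv_mul, le_div_iff₀ two_pos]
  refine (mul_le_mul_of_nonneg_left h2 (by positivity)).trans ?_
  rw [← Real.rpow_add two_pos, ← Real.rpow_add two_pos]
  refine Real.rpow_le_rpow_of_exponent_le one_le_two (le_of_eq ?_)
  ring

/-- Covering: a typical word drawn uniformly is jointly typical with a given typical word with
probability at least about `2 ^ (-n I)`. -/
theorem eventually_covering_le_count {r : A × B → ℝ} (hr : r ∈ stdSimplex ℝ (A × B))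
    {δ δ₁ δ₂ γ : ℝ} (hδ : δ₁ < δ) (hδ₂ : δ₁ < δ₂)
    (hγ : δ * entropy (law r Prod.snd) + δ₂ * (entropy r - entropy (law r Prod.fst)) < γ) :
    ∀ᶠ n : ℕ in Filter.atTop, ∀ w ∈ typicalSet δ₁ n (law r Prod.fst),
      (2 : ℝ) ^ (-((n : ℝ) * (entropy (law r Prod.fst) + entropy (law r Prod.snd) - entropy r + γ)))
        * (typicalSet δ n (law r Prod.snd)).card ≤
      probOf (fun _ => 1) (fun b : Fin n → B => b ∈ typicalSet δ n (law r Prod.snd) ∧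
        zipWord w b ∈ typicalSet δ₂ n r) := by
  have hcond : 0 ≤ entropy r - entropy (law r Prod.fst) := by
    obtain ⟨W, hW, hrW⟩ := exists_kernel hr
    rw [← sum_mul_logb_kernel hr hrW, ← Finset.sum_neg_distrib]
    refine Finset.sum_nonneg fun c _ => ?_
    rcases (hr.1 c).eq_or_lt with h0 | hpos
    · simp [← h0]
    · have h := kernel_pos_le_one hW hrW c hpos
      have := Real.logb_nonpos one_lt_two h.1.le h.2
      nlinarith
  -- With tolerance min δ δ₂ a jointly typical pair meets both requirements at once; as H(B|A) ≥ 0,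
  -- the smaller tolerance does not hurt the exponent.
  filter_upwards [eventually_le_count_zipWord_typical hr (lt_min hδ hδ₂),
    eventually_le_rpow 2 (sub_pos.2 hγ)] with n h1 h2 w hw
  refine le_trans ?_ ((h1 w hw).trans (probOf_mono (fun _ => zero_le_one) fun b hb => ?_))
  · refine (mul_le_mul_of_nonneg_left (card_typicalSet_le (law_mem_stdSimplex hr Prod.snd) δ n)
      (by positivity)).trans ?_
    rw [inv_mul_eq_div, le_div_iff₀ two_pos]
    refine (mul_le_mul_of_nonneg_left h2 (by positivity)).trans ?_
    rw [← Real.rpow_add two_pos, ← Real.rpow_add two_pos]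
    refine Real.rpow_le_rpow_of_exponent_le one_le_two ?_
    have h3 : min δ δ₂ * (entropy r - entropy (law r Prod.fst)) ≤
        δ₂ * (entropy r - entropy (law r Prod.fst)) :=
      mul_le_mul_of_nonneg_right (min_le_right _ _) hcond
    have h4 := mul_le_mul_of_nonneg_left h3 (Nat.cast_nonneg (α := ℝ) n)
    nlinarith [h4]
  · exact ⟨map_mem_typicalSet (typicalSet_mono (min_le_left _ _) hr.1 hb) Prod.snd,
      typicalSet_mono (min_le_right _ _) hr.1 hb⟩

end Counting

/-! ### The lexicographic search. -/

section FirstPair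

variable {M M' : ℕ} {Q Q' : Fin M → Fin M' → Prop} {p : Fin M × Fin M'}

theorem mem_finRange_product (p : Fin M × Fin M') : p ∈ List.finRange M ×ˢ List.finRange M' :=
  List.mem_product.2 ⟨List.mem_finRange _, List.mem_finRange _⟩

theorem prop_of_firstPair_eq_some (h : firstPair Q = some p) : Q p.1 p.2 := by
  simpa using List.find?_some h

theorem not_of_firstPair_eq_none (h : firstPair Q = none) (i : Fin M) (j : Fin M') : ¬ Q i j := by
  simpa using List.find?_eq_none.1 h (i, j) (mem_finRange_product _)

/-- Restricting a search does not change its result as long as the result survives the restriction.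
This replaces the search of the encoder by one that ignores a row or a column. -/
theorem firstPair_eq_some_of_imp (h : firstPair Q = some p) (himp : ∀ i j, Q' i j → Q i j)
    (hp : Q' p.1 p.2) : firstPair Q' = some p := by
  rw [firstPair, List.find?_eq_some_iff_append] at h ⊢
  obtain ⟨-, l₁, l₂, hl, hne⟩ := h
  refine ⟨by simpa using hp, l₁, l₂, hl, fun q hq => ?_⟩
  have := hne q hq
  simp only [Bool.not_eq_eq_eq_not, Bool.not_true, decide_eq_false_iff_not] at this ⊢
  exact fun hcon => this (himp _ _ hcon)

theorem firstPair_eq_some_of_unique (hp : Q p.1 p.2) (h : ∀ q : Fin M × Fin M', q ≠ p → ¬ Q q.1 q.2) :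
    firstPair Q = some p := by
  rcases hfp : firstPair Q with _ | q
  · exact absurd hp (not_of_firstPair_eq_none hfp _ _)
  · have hq := prop_of_firstPair_eq_some hfp
    by_cases hqp : q = p
    · rw [hqp]
    · exact absurd hq (h q hqp)

end FirstPair

/-! ### Averages over random codebooks. -/

section Resampling

/-- Redrawing one coordinate, read by `get` and set by `upd`, of a uniformly distributed object. -/
theorem sum_get_le_of_resample {γ β : Type*} {C : Finset γ} {S : Finset β} {get : γ → β}
    {upd : γ → β → γ} (hget : ∀ c ∈ C, get c ∈ S) (hupd : ∀ c ∈ C, ∀ b ∈ S, upd c b ∈ C)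
    (hgu : ∀ c b, get (upd c b) = b) (huu : ∀ c b, upd (upd c b) (get c) = c)
    {F : γ → β → ℝ} (hF : ∀ c b b', F (upd c b) b' = F c b') {G : γ → ℝ} {ρ : ℝ}
    (hG : ∀ c ∈ C, ∑ b ∈ S, F c b ≤ ρ * S.card * G c) :
    ∑ c ∈ C, F c (get c) ≤ ρ * ∑ c ∈ C, G c := by
  rcases C.eq_empty_or_nonempty with rfl | ⟨c₀, hc₀⟩
  · simp
  have hS : (0 : ℝ) < S.card := by
    exact_mod_cast Finset.card_pos.2 ⟨_, hget c₀ hc₀⟩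
  -- Exchanging the current coordinate with the fresh one is an involution of `C ×ˢ S`, so the
  -- current coordinate may be treated as an independent uniform draw.
  have hswap : ∑ x ∈ C ×ˢ S, F x.1 (get x.1) = ∑ x ∈ C ×ˢ S, F x.1 x.2 := by
    refine Finset.sum_nbij' (fun x => (upd x.1 x.2, get x.1)) (fun x => (upd x.1 x.2, get x.1))
      ?_ ?_ ?_ ?_ ?_
    · intro x hx
      rw [Finset.mem_product] at hx ⊢
      exact ⟨hupd _ hx.1 _ hx.2, hget _ hx.1⟩
    · intro x hx
      rw [Finset.mem_product] at hx ⊢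
      exact ⟨hupd _ hx.1 _ hx.2, hget _ hx.1⟩
    · intro x _
      simp [hgu, huu]
    · intro x _
      simp [hgu, huu]
    · intro x _
      simp [hF]
  rw [Finset.sum_product, Finset.sum_product] at hswap
  simp only [Finset.sum_const, nsmul_eq_mul] at hswap
  rw [← Finset.mul_sum] at hswap
  have h := Finset.sum_le_sum hG
  rw [← hswap, ← Finset.mul_sum] at h
  refine le_of_mul_le_mul_left (h.trans (le_of_eq ?_)) hS
  ring

end Resampling

section RandomCode

variable {α β : Type*} {M M' : ℕ}

/-- The pairs of codebooks with words in `S` and in `S'`. -/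
noncomputable def codes (S : Finset α) (S' : Finset β) (M M' : ℕ) :
    Finset ((Fin M → α) × (Fin M → Fin M' → β)) :=
  (Fintype.piFinset fun _ => S) ×ˢ (Fintype.piFinset fun _ => Fintype.piFinset fun _ => S')

theorem card_codes (S : Finset α) (S' : Finset β) :
    ((codes S S' M M').card : ℝ) = ((S.card : ℝ) * (S'.card : ℝ) ^ M') ^ M := by
  simp [codes, Fintype.card_piFinset, mul_pow]

theorem mem_codes {S : Finset α} {S' : Finset β} {c : (Fin M → α) × (Fin M → Fin M' → β)} :
    c ∈ codes S S' M M' ↔ (∀ i, c.1 i ∈ S) ∧ ∀ i j, c.2 i j ∈ S' := by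
  simp [codes]

theorem sum_codes_resample_left {S : Finset α} {S' : Finset β} (i : Fin M)
    {F : (Fin M → α) × (Fin M → Fin M' → β) → α → ℝ}
    (hF : ∀ c b b', F (Function.update c.1 i b, c.2) b' = F c b')
    {G : (Fin M → α) × (Fin M → Fin M' → β) → ℝ} {ρ : ℝ}
    (hG : ∀ c, ∑ b ∈ S, F c b ≤ ρ * S.card * G c) :
    ∑ c ∈ codes S S' M M', F c (c.1 i) ≤ ρ * ∑ c ∈ codes S S' M M', G c := by
  refine sum_get_le_of_resample (get := fun c => c.1 i)
    (upd := fun c b => (Function.update c.1 i b, c.2)) (fun c hc => (mem_codes.1 hc).1 i)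
    (fun c hc b hb => mem_codes.2 ⟨fun i' => ?_, (mem_codes.1 hc).2⟩) (fun c b => by simp)
    (fun c b => by simp) hF fun c _ => hG c
  by_cases h : i' = i
  · subst h
    simpa using hb
  · simpa [Function.update_of_ne h] using (mem_codes.1 hc).1 i'

theorem sum_codes_resample_right {S : Finset α} {S' : Finset β} (i : Fin M) (j : Fin M')
    {F : (Fin M → α) × (Fin M → Fin M' → β) → β → ℝ}
    (hF : ∀ c b b', F (c.1, Function.update c.2 i (Function.update (c.2 i) j b)) b' = F c b')
    {G : (Fin M → α) × (Fin M → Fin M' → β) → ℝ} {σ : ℝ}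
    (hG : ∀ c, ∑ b ∈ S', F c b ≤ σ * S'.card * G c) :
    ∑ c ∈ codes S S' M M', F c (c.2 i j) ≤ σ * ∑ c ∈ codes S S' M M', G c := by
  refine sum_get_le_of_resample (get := fun c => c.2 i j)
    (upd := fun c b => (c.1, Function.update c.2 i (Function.update (c.2 i) j b)))
    (fun c hc => (mem_codes.1 hc).2 i j)
    (fun c hc b hb => mem_codes.2 ⟨(mem_codes.1 hc).1, fun i' j' => ?_⟩) (fun c b => by simp)
    (fun c b => by simp) hF fun c _ => hG c
  by_cases h : i' = i
  · subst h
    by_cases h' : j' = j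
    · subst h'
      simpa using hb
    · simpa [Function.update_of_ne h'] using (mem_codes.1 hc).2 i' j'
  · simpa [Function.update_of_ne h] using (mem_codes.1 hc).2 i' j'

theorem sum_ite_eq_some_le_one {γ : Type*} [Fintype γ] [DecidableEq γ] (o : Option γ) :
    ∑ p, (if o = some p then (1 : ℝ) else 0) ≤ 1 := by
  rcases o with _ | q
  · simp
  · simp

/-- The expected number of wrong pairs that look right: rows other than the chosen one. -/
theorem sum_codes_wrong_row_le {S : Finset α} {S' : Finset β} (a : α → Prop) (b : β → Prop)
    {f : α → ℝ} {g : β → β → ℝ} (hf : ∀ z, 0 ≤ f z) {ρ σ : ℝ} (hρ : 0 ≤ ρ) (hσ : 0 ≤ σ)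
    (hfS : ∑ z ∈ S, f z ≤ ρ * S.card) (hgS : ∀ t, ∑ t' ∈ S', g t t' ≤ σ * S'.card)
    (q : Fin M × Fin M') :
    ∑ c ∈ codes S S' M M', ∑ p : Fin M × Fin M',
      (if firstPair (fun i j => i ≠ q.1 ∧ a (c.1 i) ∧ b (c.2 i j)) = some p then (1 : ℝ) else 0) *
        (f (c.1 q.1) * g (c.2 p.1 p.2) (c.2 q.1 q.2)) ≤ ρ * σ * (codes S S' M M').card := by
  set I : (Fin M → α) × (Fin M → Fin M' → β) → Fin M × Fin M' → ℝ := fun c p =>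
    if firstPair (fun i j => i ≠ q.1 ∧ a (c.1 i) ∧ b (c.2 i j)) = some p then (1 : ℝ) else 0
  have hI0 : ∀ c p, 0 ≤ I c p := fun c p => by simp only [I]; positivity
  have hI1 : ∀ c, ∑ p, I c p ≤ 1 := fun c => sum_ite_eq_some_le_one _
  have hIrow : ∀ c p, p.1 = q.1 → I c p = 0 := by
    intro c p hp
    refine if_neg fun h => ?_
    exact (prop_of_firstPair_eq_some h).1 hp
  -- The restricted search never reads row `q.1`, so redrawing words of that row leaves its result
  -- alone.
  have hIcongr : ∀ (c c' : (Fin M → α) × (Fin M → Fin M' → β)) p,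
      (∀ i, i ≠ q.1 → c.1 i = c'.1 i ∧ c.2 i = c'.2 i) → I c p = I c' p := by
    intro c c' p h
    have : (fun i j => i ≠ q.1 ∧ a (c.1 i) ∧ b (c.2 i j)) =
        fun i j => i ≠ q.1 ∧ a (c'.1 i) ∧ b (c'.2 i j) := by
      funext i j
      by_cases hi : i = q.1
      · simp [hi]
      · rw [(h i hi).1, (h i hi).2]
    simp only [I, this]
  -- Redrawing the t-word of the wrong pair gains σ; redrawing its z-word afterwards gains ρ. What
  -- is left sums to at most 1, as the search has at most one result.
  have step1 : ∑ c ∈ codes S S' M M', ∑ p, I c p * (f (c.1 q.1) * g (c.2 p.1 p.2) (c.2 q.1 q.2)) ≤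
      σ * ∑ c ∈ codes S S' M M', ∑ p, I c p * f (c.1 q.1) := by
    refine sum_codes_resample_right q.1 q.2
      (F := fun c t => ∑ p, I c p * (f (c.1 q.1) * g (c.2 p.1 p.2) t)) ?_ ?_
    · intro c t t'
      refine Finset.sum_congr rfl fun p _ => ?_
      have h1 : I (c.1, Function.update c.2 q.1 (Function.update (c.2 q.1) q.2 t)) p = I c p :=
        hIcongr _ _ p fun i hi => by simp [Function.update_of_ne hi]
      rw [h1]
      by_cases hp : p.1 = q.1
      · simp [hIrow c p hp]
      · simp [Function.update_of_ne hp]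
    · intro c
      rw [Finset.sum_comm, Finset.mul_sum]
      refine Finset.sum_le_sum fun p _ => ?_
      simp_rw [← mul_assoc]
      rw [← Finset.mul_sum]
      refine (mul_le_mul_of_nonneg_left (hgS _) (mul_nonneg (hI0 c p) (hf _))).trans (le_of_eq ?_)
      ring
  have step2 : ∑ c ∈ codes S S' M M', ∑ p, I c p * f (c.1 q.1) ≤
      ρ * ∑ c ∈ codes S S' M M', ∑ p, I c p := by
    refine sum_codes_resample_left q.1 (F := fun c z => ∑ p, I c p * f z) ?_ ?_
    · intro c z z'
      refine Finset.sum_congr rfl fun p _ => ?_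
      rw [hIcongr (Function.update c.1 q.1 z, c.2) c p
        fun i hi => by simp [Function.update_of_ne hi]]
    · intro c
      simp_rw [← Finset.sum_mul, ← Finset.mul_sum]
      rw [mul_comm]
      exact mul_le_mul_of_nonneg_right hfS (Finset.sum_nonneg fun p _ => hI0 c p)
  have step3 : ∑ c ∈ codes S S' M M', ∑ p, I c p ≤ (codes S S' M M').card := by
    simpa using Finset.sum_le_sum fun c (_ : c ∈ codes S S' M M') => hI1 c
  calc _ ≤ σ * (ρ * (codes S S' M M').card) :=
        step1.trans (mul_le_mul_of_nonneg_left
          (step2.trans (mul_le_mul_of_nonneg_left step3 hρ)) hσ)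
    _ = _ := by ring

/-- The expected number of wrong pairs that look right: the chosen row. -/
theorem sum_codes_wrong_column_le {S : Finset α} {S' : Finset β} (a : α → Prop) (b : β → Prop)
    {g : β → β → ℝ} {σ : ℝ} (hσ : 0 ≤ σ)
    (hgS : ∀ t, ∑ t' ∈ S', g t t' ≤ σ * S'.card) (j₀ : Fin M') :
    ∑ c ∈ codes S S' M M', ∑ p : Fin M × Fin M',
      (if firstPair (fun i j => j ≠ j₀ ∧ a (c.1 i) ∧ b (c.2 i j)) = some p then (1 : ℝ) else 0) *
        g (c.2 p.1 p.2) (c.2 p.1 j₀) ≤ σ * (codes S S' M M').card := by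
  set I : (Fin M → α) × (Fin M → Fin M' → β) → Fin M × Fin M' → ℝ := fun c p =>
    if firstPair (fun i j => j ≠ j₀ ∧ a (c.1 i) ∧ b (c.2 i j)) = some p then (1 : ℝ) else 0
  have hI0 : ∀ c p, 0 ≤ I c p := fun c p => by simp only [I]; positivity
  have hI1 : ∀ c, ∑ p, I c p ≤ 1 := fun c => sum_ite_eq_some_le_one _
  have hIcol : ∀ c p, p.2 = j₀ → I c p = 0 := by
    intro c p hp
    refine if_neg fun h => ?_
    exact (prop_of_firstPair_eq_some h).1 hp
  -- The word to redraw lies in the row of the search result, so the result `p` is fixed before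
  -- redrawing. Ignoring column `j₀` in all rows makes the search independent of that word.
  have step1 : ∀ p, ∑ c ∈ codes S S' M M', I c p * g (c.2 p.1 p.2) (c.2 p.1 j₀) ≤
      σ * ∑ c ∈ codes S S' M M', I c p := by
    intro p
    refine sum_codes_resample_right p.1 j₀ (F := fun c t => I c p * g (c.2 p.1 p.2) t) ?_ ?_
    · intro c t t'
      have h1 : I (c.1, Function.update c.2 p.1 (Function.update (c.2 p.1) j₀ t)) p = I c p := by
        have : (fun i j => j ≠ j₀ ∧ a (c.1 i) ∧
            b (Function.update c.2 p.1 (Function.update (c.2 p.1) j₀ t) i j)) =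
            fun i j => j ≠ j₀ ∧ a (c.1 i) ∧ b (c.2 i j) := by
          funext i j
          by_cases hj : j = j₀
          · simp [hj]
          · by_cases hi : i = p.1
            · subst hi
              simp [Function.update_of_ne hj]
            · simp [Function.update_of_ne hi]
        simp only [I, this]
      simp only [h1]
      by_cases hp : p.2 = j₀
      · simp [hIcol c p hp]
      · simp [Function.update_of_ne hp]
    · intro c
      rw [← Finset.mul_sum]
      refine (mul_le_mul_of_nonneg_left (hgS _) (hI0 c p)).trans (le_of_eq ?_)
      ring
  have step3 : ∑ c ∈ codes S S' M M', ∑ p, I c p ≤ (codes S S' M M').card := by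
    simpa using Finset.sum_le_sum fun c (_ : c ∈ codes S S' M M') => hI1 c
  rw [Finset.sum_comm]
  refine (Finset.sum_le_sum fun p _ => step1 p).trans ?_
  rw [← Finset.mul_sum, Finset.sum_comm]
  exact mul_le_mul_of_nonneg_left step3 hσ

/-- The probability that no pair of the random codebooks passes the encoder's test. -/
theorem sum_codes_firstPair_none_le {S : Finset α} {S' : Finset β} (a : α → Prop) (b : β → Prop)
    {π π' : ℝ} (hπ' : 0 ≤ π')
    (ha : π * S.card ≤ (S.filter a).card) (hb : π' * S'.card ≤ (S'.filter b).card) :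
    ∑ c ∈ codes S S' M M',
      (if firstPair (fun i j => a (c.1 i) ∧ b (c.2 i j)) = none then (1 : ℝ) else 0) ≤
      Real.exp (-(M * (π * (1 - Real.exp (-(M' * π')))))) * (codes S S' M M').card := by
  set h : α → (Fin M' → β) → ℝ := fun z r => if a z ∧ ∃ j, b (r j) then 0 else 1 with hh
  have h1 : ∀ c ∈ codes S S' M M',
      (if firstPair (fun i j => a (c.1 i) ∧ b (c.2 i j)) = none then (1 : ℝ) else 0) ≤
        ∏ i, h (c.1 i) (c.2 i) := by
    intro c _
    split_ifs with hn
    · refine le_of_eq (Finset.prod_eq_one fun i _ => if_neg ?_).symm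
      rintro ⟨hai, j, hbj⟩
      exact not_of_firstPair_eq_none hn i j ⟨hai, hbj⟩
    · refine Finset.prod_nonneg fun i _ => ?_
      simp only [hh]
      positivity
  refine (Finset.sum_le_sum h1).trans ?_
  -- `h` is the indicator that a single row offers no acceptable pair. Rows are independent, so the
  -- average is an M-th power.
  have h2 : ∑ c ∈ codes S S' M M', ∏ i, h (c.1 i) (c.2 i) =
      (∑ z ∈ S, ∑ r ∈ Fintype.piFinset fun _ : Fin M' => S', h z r) ^ M := by
    rw [codes, Finset.sum_product]
    have : ∀ z : Fin M → α, ∑ t ∈ Fintype.piFinset fun _ : Fin M =>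
        Fintype.piFinset fun _ : Fin M' => S', ∏ i, h (z i) (t i) =
        ∏ i, ∑ r ∈ Fintype.piFinset fun _ : Fin M' => S', h (z i) r := fun z =>
      (Finset.prod_univ_sum (fun _ => Fintype.piFinset fun _ : Fin M' => S')
        fun i r => h (z i) r).symm
    simp_rw [this]
    rw [← Finset.prod_univ_sum (fun _ : Fin M => S)
      fun _ z => ∑ r ∈ Fintype.piFinset fun _ : Fin M' => S', h z r]
    simp
  rw [h2, card_codes]
  set s : ℝ := (S.card : ℝ)
  set s' : ℝ := (S'.card : ℝ)
  have hs' : 0 ≤ s' := Nat.cast_nonneg _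
  have hs : 0 ≤ s := Nat.cast_nonneg _
  -- A row whose z-word passes fails with probability at most (1 - π')^M' ≤ exp(-M'π'); a row whose
  -- z-word does not pass always fails.
  have hrow : ∀ z, ∑ r ∈ Fintype.piFinset fun _ : Fin M' => S', h z r ≤
      s' ^ M' * (1 - if a z then 1 - Real.exp (-(M' * π')) else 0) := by
    intro z
    by_cases hz : a z
    · have h3 : ∑ r ∈ Fintype.piFinset fun _ : Fin M' => S', h z r =
          ((S'.filter fun t => ¬ b t).card : ℝ) ^ M' := by
        have : ∀ r : Fin M' → β, h z r = if (∀ j, ¬ b (r j)) then 1 else 0 := by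
          intro r
          by_cases hr : ∃ j, b (r j)
          · have hr' : ¬ ∀ j, ¬ b (r j) := by simpa using hr
            simp only [hh]
            rw [if_pos ⟨hz, hr⟩, if_neg hr']
          · have hr' : ∀ j, ¬ b (r j) := by simpa using hr
            simp only [hh]
            rw [if_neg fun hcon => hr hcon.2, if_pos hr']
        simp_rw [this]
        rw [Finset.sum_boole]
        have h4 : (Fintype.piFinset fun _ : Fin M' => S').filter (fun r => ∀ j, ¬ b (r j)) =
            Fintype.piFinset fun _ : Fin M' => S'.filter fun t => ¬ b t := by
          ext r
          simp [forall_and]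
        rw [h4, Fintype.card_piFinset]
        simp
      have h5 : ((S'.filter fun t => ¬ b t).card : ℝ) ≤ s' * Real.exp (-π') := by
        have h6 := Finset.card_filter_add_card_filter_not (s := S') b
        have h7 : ((S'.filter b).card : ℝ) + ((S'.filter fun t => ¬ b t).card : ℝ) = s' := by
          simp only [s']
          exact_mod_cast h6
        have h8 := mul_le_mul_of_nonneg_left (Real.add_one_le_exp (-π')) hs'
        linarith
      rw [h3, if_pos hz, sub_sub_cancel]
      refine (pow_le_pow_left₀ (Nat.cast_nonneg _) h5 M').trans (le_of_eq ?_)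
      rw [mul_pow, ← Real.exp_nat_mul, mul_neg]
    · rw [if_neg hz, sub_zero, mul_one]
      have : ∀ r : Fin M' → β, h z r = 1 := fun r => if_neg fun hcon => hz hcon.1
      simp [this, Fintype.card_piFinset, s']
  set e := Real.exp (-(M' * π')) with he
  have hsum : ∑ z ∈ S, ∑ r ∈ Fintype.piFinset fun _ : Fin M' => S', h z r ≤
      s * s' ^ M' * Real.exp (-(π * (1 - e))) := by
    have he1 : e ≤ 1 := Real.exp_le_one_iff.2 (neg_nonpos.2 (by positivity))
    refine (Finset.sum_le_sum fun z _ => hrow z).trans ?_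
    rw [← Finset.mul_sum, Finset.sum_sub_distrib, ← Finset.sum_filter]
    simp only [Finset.sum_const, nsmul_eq_mul, mul_one]
    have h9 := mul_le_mul_of_nonneg_right ha (sub_nonneg.2 he1)
    have h10 := mul_le_mul_of_nonneg_left (Real.add_one_le_exp (-(π * (1 - e)))) hs
    calc s' ^ M' * (s - ((S.filter a).card : ℝ) * (1 - e)) ≤
          s' ^ M' * (s * Real.exp (-(π * (1 - e)))) := by
            refine mul_le_mul_of_nonneg_left ?_ (by positivity)
            linarith
      _ = _ := by ring
  have hnn : 0 ≤ ∑ z ∈ S, ∑ r ∈ Fintype.piFinset fun _ : Fin M' => S', h z r :=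
    Finset.sum_nonneg fun z _ => Finset.sum_nonneg fun r _ => by
      simp only [hh]
      positivity
  refine (pow_le_pow_left₀ hnn hsum M).trans (le_of_eq ?_)
  rw [mul_pow, ← Real.exp_nat_mul, mul_neg, mul_comm]

end RandomCode

/-! ### Product spaces and the decoding error for a fixed codebook. -/

section Prob

variable {Ω Ω' : Type*} [Fintype Ω] [Fintype Ω']

theorem probOf_or_le {p : Ω → ℝ} (hp : ∀ ω, 0 ≤ p ω) (E F : Ω → Prop) :
    probOf p (fun ω => E ω ∨ F ω) ≤ probOf p E + probOf p F := by
  simp_rw [probOf_eq_sum_ite]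
  rw [← Finset.sum_add_distrib]
  refine Finset.sum_le_sum fun ω _ => ?_
  have := hp ω
  by_cases hE : E ω <;> by_cases hF : F ω <;> simp [hE, hF, this]

theorem mul_mem_stdSimplex {p : Ω → ℝ} {p' : Ω' → ℝ} (hp : p ∈ stdSimplex ℝ Ω)
    (hp' : p' ∈ stdSimplex ℝ Ω') :
    (fun x : Ω × Ω' => p x.1 * p' x.2) ∈ stdSimplex ℝ (Ω × Ω') := by
  refine ⟨fun x => mul_nonneg (hp.1 _) (hp'.1 _), ?_⟩
  rw [Fintype.sum_prod_type, ← Finset.sum_mul_sum, hp.2, hp'.2, one_mul]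

theorem probOf_mul_and (p : Ω → ℝ) (p' : Ω' → ℝ) (E : Ω → Prop) (E' : Ω' → Prop) :
    probOf (fun x : Ω × Ω' => p x.1 * p' x.2) (fun x => E x.1 ∧ E' x.2) =
      probOf p E * probOf p' E' := by
  simp_rw [probOf_eq_sum_ite]
  rw [Fintype.sum_prod_type, Finset.sum_mul_sum]
  refine Finset.sum_congr rfl fun x _ => Finset.sum_congr rfl fun y _ => ?_
  by_cases hE : E x <;> by_cases hF : E' y <;> simp [hE, hF]

theorem probOf_mul_left (p : Ω → ℝ) {p' : Ω' → ℝ} (hp' : ∑ ω, p' ω = 1) (E : Ω → Prop) :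
    probOf (fun x : Ω × Ω' => p x.1 * p' x.2) (fun x => E x.1) = probOf p E := by
  have := probOf_mul_and p p' E fun _ => True
  simpa [probOf, hp'] using this

theorem probOf_mul_right {p : Ω → ℝ} (p' : Ω' → ℝ) (hp : ∑ ω, p ω = 1) (E : Ω' → Prop) :
    probOf (fun x : Ω × Ω' => p x.1 * p' x.2) (fun x => E x.2) = probOf p' E := by
  have := probOf_mul_and p p' (fun _ => True) E
  simpa [probOf, hp] using this

/-- Double counting: a packing bound for each received word bounds the total acceptance probability
of the candidate codewords, whatever the law of the received word. -/
theorem sum_probOf_le {p : Ω → ℝ} (hp : p ∈ stdSimplex ℝ Ω) {S : Finset Ω'}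
    {A : Ω → Ω' → Prop} {c : ℝ} (h : ∀ ω, probOf (fun _ => 1) (fun z => z ∈ S ∧ A ω z) ≤ c) :
    ∑ z ∈ S, probOf p (fun ω => A ω z) ≤ c := by
  have h1 : ∑ z ∈ S, probOf p (fun ω => A ω z) =
      ∑ ω, p ω * probOf (fun _ => 1) (fun z => z ∈ S ∧ A ω z) := by
    simp_rw [probOf_eq_sum_ite]
    rw [Finset.sum_comm]
    refine Finset.sum_congr rfl fun ω _ => ?_
    rw [Finset.mul_sum, ← Finset.sum_subset (Finset.subset_univ S)]
    · refine Finset.sum_congr rfl fun z hz => ?_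
      by_cases hA : A ω z <;> simp [hA, hz]
    · intro z _ hz
      simp [hz]
  rw [h1]
  calc _ ≤ ∑ ω, p ω * c := Finset.sum_le_sum fun ω _ => mul_le_mul_of_nonneg_left (h ω) (hp.1 ω)
    _ = c := by rw [← Finset.sum_mul, hp.2, one_mul]

theorem count_mem_and (S : Finset Ω) (E : Ω → Prop) :
    probOf (fun _ => 1) (fun ω => ω ∈ S ∧ E ω) = (S.filter E).card := by
  have : S.filter E = Finset.univ.filter fun ω => ω ∈ S ∧ E ω := by
    ext
    simp
  rw [this]
  simp [probOf]

end Prob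

variable {α β R Y V : Type*} [Fintype R] [Fintype Y] [Fintype V]
  {M M' : ℕ}

/-- Union bound over the ways to miss `p`: it fails one of its two tests, or another pair passes
both. The acceptance probability factors because the side information and the channel output are
independent here. -/
theorem one_sub_decoding_le [NeZero M] [NeZero M'] {wy : Y → ℝ} (hwy : wy ∈ stdSimplex ℝ Y)
    {w : V → ℝ} (hw : w ∈ stdSimplex ℝ V) (A : R → Y → α → Prop) (B : R → V → β → Prop)
    (z : Fin M → α) (t : Fin M → Fin M' → β) (p : Fin M × Fin M') :
    1 - ∑ y, ∑ v, wy y * w v *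
      (if ∀ k, (firstPair fun i j => A k y (z i) ∧ B k v (t i j)).getD (0, 0) = p then 1 else 0) ≤
    ∑ k, (probOf wy (fun y => ¬ A k y (z p.1)) + (probOf w (fun v => ¬ B k v (t p.1 p.2)) +
      ∑ q : Fin M × Fin M', if q ≠ p then
        probOf wy (fun y => A k y (z q.1)) * probOf w (fun v => B k v (t q.1 q.2)) else 0)) := by
  set μ : Y × V → ℝ := fun x => wy x.1 * w x.2 with hμ
  have hμs : μ ∈ stdSimplex ℝ (Y × V) := mul_mem_stdSimplex hwy hw
  have h1 : ∑ y, ∑ v, wy y * w v *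
      (if ∀ k, (firstPair fun i j => A k y (z i) ∧ B k v (t i j)).getD (0, 0) = p
        then (1 : ℝ) else 0) =
      probOf μ fun x => ∀ k,
        (firstPair fun i j => A k x.1 (z i) ∧ B k x.2 (t i j)).getD (0, 0) = p := by
    rw [probOf_eq_sum_ite, Fintype.sum_prod_type]
    simp [hμ]
  have h2 := probOf_add_probOf_not μ fun x => ∀ k,
    (firstPair fun i j => A k x.1 (z i) ∧ B k x.2 (t i j)).getD (0, 0) = p
  rw [hμs.2] at h2
  rw [h1, ← h2, add_sub_cancel_left]
  refine (probOf_mono hμs.1 (F := fun x => ∃ k, ¬ A k x.1 (z p.1) ∨ (¬ B k x.2 (t p.1 p.2) ∨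
    ∃ q : Fin M × Fin M', q ≠ p ∧ (A k x.1 (z q.1) ∧ B k x.2 (t q.1 q.2)))) ?_).trans ?_
  · intro x hx
    by_contra hcon
    refine hx fun k => ?_
    push Not at hcon
    obtain ⟨hA, hB, hq⟩ := hcon k
    rw [firstPair_eq_some_of_unique (p := p) ⟨hA, hB⟩ fun q hqp hcon =>
      hq q hqp hcon.1 hcon.2]
    rfl
  · refine (probOf_exists_le hμs.1 _).trans (Finset.sum_le_sum fun k _ => ?_)
    refine (probOf_or_le hμs.1 _ _).trans (add_le_add (le_of_eq ?_) ?_)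
    · exact probOf_mul_left wy hw.2 fun y => ¬ A k y (z p.1)
    refine (probOf_or_le hμs.1 _ _).trans (add_le_add (le_of_eq ?_) ?_)
    · exact probOf_mul_right w hwy.2 fun v => ¬ B k v (t p.1 p.2)
    refine (probOf_exists_le hμs.1 _).trans (Finset.sum_le_sum fun q _ => ?_)
    split_ifs with h
    · simp only [h, true_and, ne_eq, not_false_eq_true]
      exact (probOf_mul_and wy w (fun y => A k y (z q.1)) fun v => B k v (t q.1 q.2)).le
    · simp [h, probOf]

/-! ### The random coding bound. -/

section RandomCoding

/-- The probability that the encoder finds a pair of indices and that all receivers decide on it,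
for given codebooks, encoder tests `a`, `b` and decoder tests `A`, `B`. -/
noncomputable def pairSuccess [NeZero M] [NeZero M'] (a : α → Prop) (b : β → Prop)
    (A : R → Y → α → Prop) (B : R → V → β → Prop) (wy : Y → ℝ) (wv : β → V → ℝ)
    (c : (Fin M → α) × (Fin M → Fin M' → β)) : ℝ :=
  match firstPair (fun i j => a (c.1 i) ∧ b (c.2 i j)) with
  | none => 0
  | some p => ∑ y, ∑ v, wy y * wv (c.2 p.1 p.2) v *
      (if ∀ k, (firstPair fun i j => A k y (c.1 i) ∧ B k v (c.2 i j)).getD (0, 0) = p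
        then 1 else 0)

/-- The chosen pair is replaced by sums over the results of restricted searches. This loses
something for a fixed codebook but decouples each wrong word from the search, ready for averaging.
-/
theorem one_sub_pairSuccess_le [NeZero M] [NeZero M'] {a : α → Prop} {b : β → Prop}
    {A : R → Y → α → Prop} {B : R → V → β → Prop} {wy : Y → ℝ} {wv : β → V → ℝ}
    (hwy : wy ∈ stdSimplex ℝ Y) (hwv : ∀ t, wv t ∈ stdSimplex ℝ V) {ε : ℝ} (hε : 0 ≤ ε)
    (hA : ∀ z, a z → ∀ k, probOf wy (fun y => ¬ A k y z) ≤ ε)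
    (hB : ∀ t, b t → ∀ k, probOf (wv t) (fun v => ¬ B k v t) ≤ ε)
    (c : (Fin M → α) × (Fin M → Fin M' → β)) :
    1 - pairSuccess a b A B wy wv c ≤
      (if firstPair (fun i j => a (c.1 i) ∧ b (c.2 i j)) = none then 1 else 0) +
      ∑ k, (2 * ε +
        ((∑ q : Fin M × Fin M', ∑ p : Fin M × Fin M',
          (if firstPair (fun i j => i ≠ q.1 ∧ a (c.1 i) ∧ b (c.2 i j)) = some p then 1 else 0) *
            (probOf wy (fun y => A k y (c.1 q.1)) *
              probOf (wv (c.2 p.1 p.2)) (fun v => B k v (c.2 q.1 q.2)))) +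
        ∑ j₀ : Fin M', ∑ p : Fin M × Fin M',
          (if firstPair (fun i j => j ≠ j₀ ∧ a (c.1 i) ∧ b (c.2 i j)) = some p then 1 else 0) *
            probOf (wv (c.2 p.1 p.2)) (fun v => B k v (c.2 p.1 j₀)))) := by
  have hf0 : ∀ k z, 0 ≤ probOf wy (fun y => A k y z) := fun k z => probOf_nonneg hwy.1 _
  have hf1 : ∀ k z, probOf wy (fun y => A k y z) ≤ 1 := fun k z => probOf_le_one hwy _
  have hg0 : ∀ k t t', 0 ≤ probOf (wv t) (fun v => B k v t') :=
    fun k t t' => probOf_nonneg (hwv t).1 _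
  rcases h : firstPair (fun i j => a (c.1 i) ∧ b (c.2 i j)) with _ | p
  · have h0 : pairSuccess a b A B wy wv c = 0 := by
      unfold pairSuccess
      rw [h]
    rw [h0, if_pos rfl, sub_zero]
    refine le_add_of_nonneg_right (Finset.sum_nonneg fun k _ => ?_)
    refine add_nonneg (by positivity) (add_nonneg ?_ ?_)
    · exact Finset.sum_nonneg fun q _ => Finset.sum_nonneg fun p _ =>
        mul_nonneg (by positivity) (mul_nonneg (hf0 _ _) (hg0 _ _ _))
    · exact Finset.sum_nonneg fun q _ => Finset.sum_nonneg fun p _ =>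
        mul_nonneg (by positivity) (hg0 _ _ _)
  · have h0 : pairSuccess a b A B wy wv c = ∑ y, ∑ v, wy y * wv (c.2 p.1 p.2) v *
        (if ∀ k, (firstPair fun i j => A k y (c.1 i) ∧ B k v (c.2 i j)).getD (0, 0) = p
          then 1 else 0) := by
      unfold pairSuccess
      rw [h]
    have hp := prop_of_firstPair_eq_some h
    rw [h0, if_neg (by simp), zero_add]
    refine (one_sub_decoding_le hwy (hwv _) A B c.1 c.2 p).trans
      (Finset.sum_le_sum fun k _ => ?_)
    have hAk := hA _ hp.1 k
    have hBk := hB _ hp.2 k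
    -- Wrong pairs in the chosen row share the correct z-word, so the source test gives no gain
    -- there and its probability is bounded by 1.
    have hsplit : (∑ q : Fin M × Fin M', if q ≠ p then
        probOf wy (fun y => A k y (c.1 q.1)) *
          probOf (wv (c.2 p.1 p.2)) (fun v => B k v (c.2 q.1 q.2)) else 0) ≤
        ∑ q : Fin M × Fin M', ((if q.1 ≠ p.1 then probOf wy (fun y => A k y (c.1 q.1)) *
          probOf (wv (c.2 p.1 p.2)) (fun v => B k v (c.2 q.1 q.2)) else 0) +
          if q.1 = p.1 then if q.2 ≠ p.2 then
            probOf (wv (c.2 p.1 p.2)) (fun v => B k v (c.2 p.1 q.2)) else 0 else 0) := by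
      refine Finset.sum_le_sum fun q _ => ?_
      by_cases h1 : q.1 = p.1
      · by_cases h2 : q.2 = p.2
        · have : q = p := Prod.ext h1 h2
          simp [this]
        · have : q ≠ p := fun hcon => h2 (by rw [hcon])
          simp only [this, h1, h2, ne_eq, not_false_eq_true, if_true, not_true, if_false, zero_add]
          exact mul_le_of_le_one_left (hg0 _ _ _) (hf1 _ _)
      · have : q ≠ p := fun hcon => h1 (by rw [hcon])
        simp [this, h1]
    have hcol : (∑ q : Fin M × Fin M', if q.1 = p.1 then if q.2 ≠ p.2 then
        probOf (wv (c.2 p.1 p.2)) (fun v => B k v (c.2 p.1 q.2)) else 0 else 0) =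
        ∑ j₀, if j₀ ≠ p.2 then
          probOf (wv (c.2 p.1 p.2)) (fun v => B k v (c.2 p.1 j₀)) else 0 := by
      rw [Fintype.sum_prod_type, Finset.sum_eq_single p.1]
      · simp
      · intro i _ hi
        simp [hi]
      · simp
    rw [Finset.sum_add_distrib, hcol] at hsplit
    have hrow_le : (∑ q : Fin M × Fin M', if q.1 ≠ p.1 then
        probOf wy (fun y => A k y (c.1 q.1)) *
          probOf (wv (c.2 p.1 p.2)) (fun v => B k v (c.2 q.1 q.2)) else 0) ≤
        ∑ q : Fin M × Fin M', ∑ p : Fin M × Fin M',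
          (if firstPair (fun i j => i ≠ q.1 ∧ a (c.1 i) ∧ b (c.2 i j)) = some p then 1 else 0) *
            (probOf wy (fun y => A k y (c.1 q.1)) *
              probOf (wv (c.2 p.1 p.2)) (fun v => B k v (c.2 q.1 q.2))) := by
      refine Finset.sum_le_sum fun q _ => ?_
      have hnn : ∀ p ∈ Finset.univ, 0 ≤ (if firstPair
          (fun i j => i ≠ q.1 ∧ a (c.1 i) ∧ b (c.2 i j)) = some p then (1 : ℝ) else 0) *
            (probOf wy (fun y => A k y (c.1 q.1)) *
              probOf (wv (c.2 p.1 p.2)) (fun v => B k v (c.2 q.1 q.2))) :=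
        fun p _ => mul_nonneg (by positivity) (mul_nonneg (hf0 _ _) (hg0 _ _ _))
      split_ifs with hq
      · refine le_trans ?_ (Finset.single_le_sum hnn (Finset.mem_univ p))
        rw [if_pos (firstPair_eq_some_of_imp h (fun i j hij => hij.2) ⟨Ne.symm hq, hp⟩), one_mul]
      · exact Finset.sum_nonneg hnn
    have hcol_le : (∑ j₀, if j₀ ≠ p.2 then
          probOf (wv (c.2 p.1 p.2)) (fun v => B k v (c.2 p.1 j₀)) else 0) ≤
        ∑ j₀ : Fin M', ∑ p : Fin M × Fin M',
          (if firstPair (fun i j => j ≠ j₀ ∧ a (c.1 i) ∧ b (c.2 i j)) = some p then 1 else 0) *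
            probOf (wv (c.2 p.1 p.2)) (fun v => B k v (c.2 p.1 j₀)) := by
      refine Finset.sum_le_sum fun j₀ _ => ?_
      have hnn : ∀ p ∈ Finset.univ, 0 ≤ (if firstPair
          (fun i j => j ≠ j₀ ∧ a (c.1 i) ∧ b (c.2 i j)) = some p then (1 : ℝ) else 0) *
            probOf (wv (c.2 p.1 p.2)) (fun v => B k v (c.2 p.1 j₀)) :=
        fun p _ => mul_nonneg (by positivity) (hg0 _ _ _)
      split_ifs with hq
      · refine le_trans ?_ (Finset.single_le_sum hnn (Finset.mem_univ p))
        rw [if_pos (firstPair_eq_some_of_imp h (fun i j hij => hij.2) ⟨Ne.symm hq, hp⟩), one_mul]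
      · exact Finset.sum_nonneg hnn
    linarith

/-- The random coding bound. -/
theorem le_sum_pairSuccess [Fintype α] [Fintype β] [NeZero M] [NeZero M'] {a : α → Prop} {b : β → Prop}
    {A : R → Y → α → Prop} {B : R → V → β → Prop} {wy : Y → ℝ} {wv : β → V → ℝ}
    (hwy : wy ∈ stdSimplex ℝ Y) (hwv : ∀ t, wv t ∈ stdSimplex ℝ V)
    {S : Finset α} {S' : Finset β} {ε π π' : ℝ} {ρ σ : R → ℝ} (hε : 0 ≤ ε)
    (hρ : ∀ k, 0 ≤ ρ k) (hσ : ∀ k, 0 ≤ σ k)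
    (hπ' : 0 ≤ π')
    (hA : ∀ z, a z → ∀ k, probOf wy (fun y => ¬ A k y z) ≤ ε)
    (hB : ∀ t, b t → ∀ k, probOf (wv t) (fun v => ¬ B k v t) ≤ ε)
    (hAS : ∀ k y, probOf (fun _ => 1) (fun z => z ∈ S ∧ A k y z) ≤ ρ k * S.card)
    (hBS : ∀ k v, probOf (fun _ => 1) (fun t => t ∈ S' ∧ B k v t) ≤ σ k * S'.card)
    (ha : π * S.card ≤ probOf (fun _ => 1) fun z => z ∈ S ∧ a z)
    (hb : π' * S'.card ≤ probOf (fun _ => 1) fun t => t ∈ S' ∧ b t) :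
    (1 - (Real.exp (-(M * (π * (1 - Real.exp (-(M' * π')))))) +
      ∑ k, (2 * ε + (M * M' * (ρ k * σ k) + M' * σ k)))) * (codes S S' M M').card ≤
      ∑ c ∈ codes S S' M M', pairSuccess a b A B wy wv c := by
  rw [count_mem_and] at ha hb
  have h1 := Finset.sum_le_sum fun c (_ : c ∈ codes S S' M M') =>
    one_sub_pairSuccess_le hwy hwv hε hA hB c
  rw [Finset.sum_sub_distrib, Finset.sum_add_distrib, Finset.sum_comm (t := Finset.univ)] at h1
  have hnone := sum_codes_firstPair_none_le (M := M) (M' := M') a b hπ' ha hb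
  set N : ℝ := ((codes S S' M M').card : ℝ) with hN
  have hk : ∀ k : R, ∑ c ∈ codes S S' M M', (2 * ε +
        ((∑ q : Fin M × Fin M', ∑ p : Fin M × Fin M',
          (if firstPair (fun i j => i ≠ q.1 ∧ a (c.1 i) ∧ b (c.2 i j)) = some p then (1 : ℝ)
            else 0) *
            (probOf wy (fun y => A k y (c.1 q.1)) *
              probOf (wv (c.2 p.1 p.2)) (fun v => B k v (c.2 q.1 q.2)))) +
        ∑ j₀ : Fin M', ∑ p : Fin M × Fin M',
          (if firstPair (fun i j => j ≠ j₀ ∧ a (c.1 i) ∧ b (c.2 i j)) = some p then (1 : ℝ)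
            else 0) *
            probOf (wv (c.2 p.1 p.2)) (fun v => B k v (c.2 p.1 j₀)))) ≤
      (2 * ε + (M * M' * (ρ k * σ k) + M' * σ k)) * N := by
    intro k
    rw [Finset.sum_add_distrib, Finset.sum_add_distrib, Finset.sum_comm (t := Finset.univ),
      Finset.sum_comm (t := Finset.univ)]
    have h2 : ∑ q : Fin M × Fin M', ∑ c ∈ codes S S' M M', ∑ p : Fin M × Fin M',
          (if firstPair (fun i j => i ≠ q.1 ∧ a (c.1 i) ∧ b (c.2 i j)) = some p then (1 : ℝ)
            else 0) *
            (probOf wy (fun y => A k y (c.1 q.1)) *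
              probOf (wv (c.2 p.1 p.2)) (fun v => B k v (c.2 q.1 q.2))) ≤ M * M' * (ρ k * σ k * N) := by
      refine (Finset.sum_le_sum fun q _ => sum_codes_wrong_row_le a b
        (f := fun z => probOf wy fun y => A k y z) (g := fun t t' => probOf (wv t) fun v => B k v t')
        (fun z => probOf_nonneg hwy.1 _) (hρ k) (hσ k) (sum_probOf_le hwy (hAS k))
        (fun t => sum_probOf_le (hwv t) (hBS k)) q).trans (le_of_eq ?_)
      simp [hN]
    have h3 : ∑ j₀ : Fin M', ∑ c ∈ codes S S' M M', ∑ p : Fin M × Fin M',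
          (if firstPair (fun i j => j ≠ j₀ ∧ a (c.1 i) ∧ b (c.2 i j)) = some p then (1 : ℝ)
            else 0) *
            probOf (wv (c.2 p.1 p.2)) (fun v => B k v (c.2 p.1 j₀)) ≤ M' * (σ k * N) := by
      refine (Finset.sum_le_sum fun j₀ _ => sum_codes_wrong_column_le a b
        (g := fun t t' => probOf (wv t) fun v => B k v t') (hσ k)
        (fun t => sum_probOf_le (hwv t) (hBS k)) j₀).trans (le_of_eq ?_)
      simp [hN]
    refine (add_le_add_right (add_le_add h2 h3) _).trans (le_of_eq ?_)
    rw [Finset.sum_const, nsmul_eq_mul]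
    ring
  have hks := Finset.sum_le_sum fun k (_ : k ∈ Finset.univ) => hk k
  simp only [Finset.sum_const, nsmul_eq_mul, mul_one, ← Finset.sum_mul] at h1 hks
  rw [← hN] at h1
  linarith

end RandomCoding

/-! ### Marginals and Markov identities of the model. -/

theorem law_apply_of_injective {Ω A : Type*} [Fintype Ω] (p : Ω → ℝ) {f : Ω → A}
    (hf : Function.Injective f) (ω : Ω) : law p f (f ω) = p ω := by
  rw [law_eq_sum_ite, Finset.sum_eq_single ω]
  · simp
  · intro ω' _ h
    exact if_neg fun hcon => h (hf hcon)
  · simp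

theorem mutualInfo_comm {Ω A B : Type*} [Fintype Ω] [Fintype A] [Fintype B]
    (p : Ω → ℝ) (f : Ω → A) (g : Ω → B) : mutualInfo p f g = mutualInfo p g f := by
  rw [mutualInfo, mutualInfo, Finset.sum_comm]
  refine Finset.sum_congr rfl fun b _ => Finset.sum_congr rfl fun a _ => ?_
  have : law p (fun ω => (f ω, g ω)) (a, b) = law p (fun ω => (g ω, f ω)) (b, a) := by
    simp only [law_eq_sum_ite, Prod.mk.injEq, and_comm]
  rw [this, mul_comm (law p f a)]

namespace Model

variable {K : ℕ} {X : Type*} {Y : Fin K → Type*} {Z S T U : Type*} {V : Fin K → Type*}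
  [Fintype X] [∀ k, Fintype (Y k)] [Fintype Z] [Fintype S] [Fintype T] [Fintype U]
  [∀ k, Fintype (V k)]

theorem srcLaw_mem (P : Model K X Y Z S T U V) : P.srcLaw ∈ stdSimplex ℝ (X × (∀ k, Y k) × Z) := by
  refine ⟨fun ω => mul_nonneg (P.pXY_mem.1 _) ((P.pZ_mem _).1 _), ?_⟩
  rw [← P.pXY_mem.2, Fintype.sum_prod_type, Fintype.sum_prod_type]
  refine Finset.sum_congr rfl fun x _ => ?_
  rw [Fintype.sum_prod_type]
  refine Finset.sum_congr rfl fun y _ => ?_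
  simp only [srcLaw]
  rw [← Finset.mul_sum, (P.pZ_mem x).2, mul_one]

/-- The channel from `(S, T)` to the outputs `(V_1, …, V_K)`. -/
noncomputable def chan (P : Model K X Y Z S T U V) (c : S × T) (v : ∀ k, V k) : ℝ :=
  ∑ u, P.pU c.2 c.1 u * P.pV u c.1 v

theorem chan_mem (P : Model K X Y Z S T U V) (c : S × T) :
    P.chan c ∈ stdSimplex ℝ (∀ k, V k) := by
  refine ⟨fun v => Finset.sum_nonneg fun u _ =>
    mul_nonneg ((P.pU_mem _ _).1 _) ((P.pV_mem _ _).1 _), ?_⟩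
  simp only [chan]
  rw [Finset.sum_comm]
  simp only [← Finset.mul_sum, (P.pV_mem _ _).2, mul_one]
  exact (P.pU_mem _ _).2

theorem chLaw_mem (P : Model K X Y Z S T U V) :
    P.chLaw ∈ stdSimplex ℝ (S × T × U × (∀ k, V k)) := by
  refine ⟨fun ω => mul_nonneg (mul_nonneg (mul_nonneg (P.pS_mem.1 _) ((P.pT_mem _).1 _))
    ((P.pU_mem _ _).1 _)) ((P.pV_mem _ _).1 _), ?_⟩
  simp only [Fintype.sum_prod_type, chLaw, ← Finset.mul_sum, (P.pV_mem _ _).2, mul_one,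
    (P.pU_mem _ _).2, (P.pT_mem _).2, P.pS_mem.2]

theorem law_chLaw_st (P : Model K X Y Z S T U V) (s : S) (t : T) :
    law P.chLaw (fun ω => (ω.1, ω.2.1)) (s, t) = P.pS s * P.pT s t := by
  rw [law_eq_sum_ite]
  simp only [Fintype.sum_prod_type, chLaw, Prod.mk.injEq, ite_and]
  simp [← Finset.mul_sum, (P.pV_mem _ _).2, (P.pU_mem _ _).2]

theorem law_chLaw_s (P : Model K X Y Z S T U V) : law P.chLaw (fun ω => ω.1) = P.pS := by
  have h := law_law P.chLaw (fun ω => (ω.1, ω.2.1)) Prod.fst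
  rw [← h]
  funext s
  rw [law_eq_sum_ite, Fintype.sum_prod_type]
  simp_rw [law_chLaw_st]
  simp [← Finset.mul_sum, (P.pT_mem _).2]

theorem law_chLaw_stv (P : Model K X Y Z S T U V) :
    law P.chLaw (fun ω => ((ω.1, ω.2.1), ω.2.2.2)) =
      fun c => law P.chLaw (fun ω => (ω.1, ω.2.1)) c.1 * P.chan c.1 c.2 := by
  funext ⟨⟨s, t⟩, v⟩
  rw [law_eq_sum_ite, law_chLaw_st]
  simp only [Fintype.sum_prod_type, chLaw, Prod.mk.injEq, ite_and]
  simp [chan, Finset.mul_sum, mul_assoc]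

theorem law_srcLaw_xz (P : Model K X Y Z S T U V) (x : X) (z : Z) :
    law P.srcLaw (fun ω => (ω.1, ω.2.2)) (x, z) = law P.pXY Prod.fst x * P.pZ x z := by
  rw [law_eq_sum_ite, law_eq_sum_ite]
  simp only [Fintype.sum_prod_type, srcLaw, Prod.mk.injEq, ite_and]
  simp [Finset.sum_mul, Finset.sum_comm (s := (Finset.univ : Finset X))]

theorem law_srcLaw_xy (P : Model K X Y Z S T U V) :
    law P.srcLaw (fun ω => (ω.1, ω.2.1)) = P.pXY := by
  funext ⟨x, y⟩
  rw [law_eq_sum_ite]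
  simp only [Fintype.sum_prod_type, srcLaw, Prod.mk.injEq, ite_and]
  simp [← Finset.mul_sum, (P.pZ_mem _).2]

theorem law_srcLaw_x (P : Model K X Y Z S T U V) :
    law P.srcLaw (fun ω => ω.1) = law P.pXY Prod.fst := by
  rw [← P.law_srcLaw_xy, law_law]

/-- The joint law of `X`, `Z` and a function of `(X, Y_1, …, Y_K)`. -/
theorem law_srcLaw_xzc {C : Type*} (P : Model K X Y Z S T U V) (f : (∀ k, Y k) → C) (x : X) (z : Z)
    (c : C) : law P.srcLaw (fun ω => (ω.1, ω.2.2, f ω.2.1)) (x, z, c) =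
      law P.pXY (fun ω => (ω.1, f ω.2)) (x, c) * P.pZ x z := by
  rw [law_eq_sum_ite, law_eq_sum_ite]
  simp only [Fintype.sum_prod_type, srcLaw, Prod.mk.injEq, ite_and]
  simp [Finset.sum_mul, ite_mul]

/-- The chain Y_k - X - Z turns the rate condition into a comparison of the covering exponent I(X;Z)
with the packing exponent I(Y_k;Z). -/
theorem infoXZgivenY_eq (P : Model K X Y Z S T U V) (k : Fin K) :
    P.infoXZgivenY k =
      P.infoXZ - mutualInfo P.srcLaw (fun ω => ω.2.1 k) (fun ω => ω.2.2) := by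
  refine condMutualInfo_of_markov P.srcLaw_mem.1 _ _ _ fun x z c => ?_
  have h1 := P.law_srcLaw_xzc (fun y => y k) x z c
  have h2 : law P.srcLaw (fun ω => (ω.1, ω.2.1 k)) (x, c) =
      law P.pXY (fun ω => (ω.1, ω.2 k)) (x, c) := by
    rw [← P.law_srcLaw_xy, law_law]
  rw [h1, P.law_srcLaw_x, h2, P.law_srcLaw_xz]
  ring

theorem infoXZgivenY_nonneg (P : Model K X Y Z S T U V) (k : Fin K) : 0 ≤ P.infoXZgivenY k :=
  condMutualInfo_nonneg P.srcLaw_mem _ _ _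

theorem infoXZ_eq (P : Model K X Y Z S T U V) : P.infoXZ =
    entropy (law P.srcLaw fun ω => ω.1) + entropy (law P.srcLaw fun ω => ω.2.2) -
      entropy (law P.srcLaw fun ω => (ω.1, ω.2.2)) :=
  mutualInfo_eq_entropy P.srcLaw_mem.1 _ _

theorem infoST_eq (P : Model K X Y Z S T U V) : P.infoST =
    entropy (law P.chLaw fun ω => ω.1) + entropy (law P.chLaw fun ω => ω.2.1) -
      entropy (law P.chLaw fun ω => (ω.1, ω.2.1)) :=
  mutualInfo_eq_entropy P.chLaw_mem.1 _ _

theorem infoTV_eq (P : Model K X Y Z S T U V) (k : Fin K) : P.infoTV k =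
    entropy (law P.chLaw fun ω => ω.2.2.2 k) + entropy (law P.chLaw fun ω => ω.2.1) -
      entropy (law P.chLaw fun ω => (ω.2.2.2 k, ω.2.1)) := by
  rw [infoTV, mutualInfo_comm]
  exact mutualInfo_eq_entropy P.chLaw_mem.1 _ _

/-- The side information is jointly typical with every codeword that passes the encoder's test. -/
theorem eventually_probOf_not_typYZ_le (P : Model K X Y Z S T U V)
    {W : X → (∀ k, Y k) → ℝ} (hW : ∀ x, W x ∈ stdSimplex ℝ (∀ k, Y k))
    (hPW : ∀ x y, P.pXY (x, y) = law P.pXY Prod.fst x * W x y)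
    {δ' δ'' : ℝ} (hδ : δ' < δ'') {ε : ℝ} (hε : 0 < ε) :
    ∀ᶠ n : ℕ in Filter.atTop, ∀ (x : Fin n → X) (z : Fin n → Z), zipWord x z ∈ P.typXZ δ' n →
      ∀ k, probOf (fun y : Fin n → ∀ k, Y k => ∏ l, W (x l) (y l))
        (fun y => ¬ zipWord (fun l => y l k) z ∈ P.typYZ k δ'' n) ≤ ε := by
  have hr : (fun c : (X × Z) × (∀ k, Y k) =>
      law P.srcLaw (fun ω => (ω.1, ω.2.2)) c.1 * W c.1.1 c.2) =
      law P.srcLaw fun ω => ((ω.1, ω.2.2), ω.2.1) := by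
    funext ⟨⟨x, z⟩, y⟩
    have h := law_apply_of_injective P.srcLaw
      (f := fun ω : X × (∀ k, Y k) × Z => ((ω.1, ω.2.2), ω.2.1))
      (fun ω ω' h => by
        simp only [Prod.mk.injEq] at h
        exact Prod.ext h.1.1 (Prod.ext h.2 h.1.2)) (x, y, z)
    dsimp only at h ⊢
    rw [h, P.law_srcLaw_xz, srcLaw, hPW]
    ring
  have hev := eventually_forall_probOf_not_typical_le (law_nonneg P.srcLaw_mem.1
    fun ω => (ω.1, ω.2.2)) (W := fun c : X × Z => W c.1) (fun c => hW c.1) hδ hε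
  rw [hr] at hev
  filter_upwards [hev] with n hn x z hxz k
  refine le_trans (probOf_mono (fun y => Finset.prod_nonneg fun l _ => (hW _).1 _) ?_)
    (hn (zipWord x z) hxz)
  intro y hy hcon
  have h := map_mem_typicalSet hcon fun c => (c.2 k, c.1.2)
  rw [law_law] at h
  exact hy h

/-- The channel outputs are jointly typical with every codeword that passes the encoder's test. -/
theorem eventually_probOf_not_typVT_le (P : Model K X Y Z S T U V)
    {δ' δ'' : ℝ} (hδ : δ' < δ'') {ε : ℝ} (hε : 0 < ε) :
    ∀ᶠ m : ℕ in Filter.atTop, ∀ (s : Fin m → S) (t : Fin m → T), zipWord s t ∈ P.typST δ' m →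
      ∀ k, probOf (fun v : Fin m → ∀ k, V k => ∏ l, P.chan (s l, t l) (v l))
        (fun v => ¬ zipWord (fun l => v l k) t ∈ P.typVT k δ'' m) ≤ ε := by
  have hev := eventually_forall_probOf_not_typical_le (law_nonneg P.chLaw_mem.1
    fun ω => (ω.1, ω.2.1)) (W := P.chan) P.chan_mem hδ hε
  rw [← P.law_chLaw_stv] at hev
  filter_upwards [hev] with n hn s t hst k
  refine le_trans (probOf_mono (fun v => Finset.prod_nonneg fun l _ => (P.chan_mem _).1 _) ?_)
    (hn (zipWord s t) hst)
  intro v hv hcon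
  have h := map_mem_typicalSet hcon fun c => (c.2 k, c.1.2)
  rw [law_law] at h
  exact hv h

/-- The probability that all receivers decode correctly, as that of the abstract random code. -/
theorem sum_prod_mul_channelSuccess (P : Model K X Y Z S T U V) {n m M M' : ℕ} [NeZero M]
    [NeZero M'] (W : X → (∀ k, Y k) → ℝ) (δ' δ'' : ℝ)
    (c : (Fin M → Fin n → Z) × (Fin M → Fin M' → Fin m → T)) (x : Fin n → X) (s : Fin m → S) :
    ∑ y : Fin n → ∀ k, Y k, (∏ l, W (x l) (y l)) *
      channelSuccess P δ' δ'' c.1 c.2 x y s =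
    pairSuccess (fun z => zipWord x z ∈ P.typXZ δ' n) (fun t => zipWord s t ∈ P.typST δ' m)
      (fun k (y : Fin n → ∀ k, Y k) z => zipWord (fun l => y l k) z ∈ P.typYZ k δ'' n)
      (fun k (v : Fin m → ∀ k, V k) t => zipWord (fun l => v l k) t ∈ P.typVT k δ'' m)
      (fun y => ∏ l, W (x l) (y l)) (fun t v => ∏ l, P.chan (s l, t l) (v l)) c := by
  unfold channelSuccess pairSuccess encoderPair
  rcases firstPair fun i j => zipWord x (c.1 i) ∈ P.typXZ δ' n ∧
    zipWord s (c.2 i j) ∈ P.typST δ' m with _ | p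
  · simp
  · refine Finset.sum_congr rfl fun y _ => ?_
    dsimp only
    rw [Finset.sum_comm, Finset.mul_sum]
    refine Finset.sum_congr rfl fun v _ => ?_
    rw [← Finset.sum_mul, ← mul_assoc]
    -- Summing out the channel input letter by letter leaves the product of the kernels `chan`.
    simp only [chan]
    rw [← sum_prod_words fun l u => P.pU (c.2 p.1 p.2 l) (s l) u * P.pV u (s l) (v l)]
    simp only [Finset.prod_mul_distrib]
    unfold decoderPair
    congr

end Model

/-! ### Choice of constants and estimates for the model. -/

/-- Arguing with small positive numbers instead of a minimum includes the empty index type, that is,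
the case of no receivers. -/
theorem exists_pos_forall_le {ι : Type*} [Finite ι] {f : ι → ℝ} (hf : ∀ i, 0 < f i) :
    ∃ d : ℝ, 0 < d ∧ ∀ i, d ≤ f i := by
  have h : ∀ᶠ d in nhdsWithin (0 : ℝ) (Set.Ioi 0), 0 < d ∧ ∀ i, d ≤ f i := by
    refine Filter.Eventually.and self_mem_nhdsWithin (Filter.eventually_all.2 fun i => ?_)
    filter_upwards [Ioo_mem_nhdsGT (hf i)] with d hd using hd.2.le
  exact h.exists

theorem exists_pos_forall_mul_add_mul_lt (a b : ℝ) {c : ℝ} (hc : 0 < c) :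
    ∃ Δ : ℝ, 0 < Δ ∧ ∀ x y : ℝ, 0 < x → x < Δ → 0 < y → y < Δ → x * a + y * b < c := by
  refine ⟨c / (|a| + |b| + 1), by positivity, fun x y hx hxΔ hy hyΔ => ?_⟩
  have hD : 0 < |a| + |b| + 1 := by positivity
  rw [lt_div_iff₀ hD] at hxΔ hyΔ
  have h1 := mul_le_mul_of_nonneg_left (le_abs_self a) hx.le
  have h2 := mul_le_mul_of_nonneg_left (le_abs_self b) hy.le
  have h3 : 0 ≤ |a| := abs_nonneg a
  have h4 : 0 ≤ |b| := abs_nonneg b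
  rcases le_total x y with h | h <;> nlinarith

/-- Only block lengths with κn an integer matter; along them m grows with n. -/
theorem eventually_forall_eq_mul {κ : ℚ} (hκ : 0 < κ) {p : ℕ → Prop}
    (hp : ∀ᶠ m in Filter.atTop, p m) :
    ∀ᶠ n : ℕ in Filter.atTop, ∀ m : ℕ, (m : ℚ) = κ * n → p m := by
  obtain ⟨m₀, hm₀⟩ := Filter.eventually_atTop.1 hp
  filter_upwards [(tendsto_natCast_atTop_atTop (R := ℚ)).eventually_ge_atTop (m₀ / κ)]
    with n hn m hm
  refine hm₀ m ?_
  rw [div_le_iff₀ hκ] at hn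
  have : (m₀ : ℚ) ≤ m := by rw [hm, mul_comm]; exact hn
  exact_mod_cast this

theorem exp_neg_le_inv {x : ℝ} (hx : 0 < x) : Real.exp (-x) ≤ x⁻¹ := by
  rw [Real.exp_neg]
  exact inv_anti₀ hx (by linarith [Real.add_one_le_exp x])

/-- Here a and b stand for Mπ and M'π', the expected numbers of acceptable z-words and of acceptable
t-words in a row. -/
theorem exp_neg_covering_le {a b L : ℝ} (hL : 2 ≤ L) (ha : L ≤ a) (hb : L ≤ b) :
    Real.exp (-(a * (1 - Real.exp (-b)))) ≤ 2 / L := by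
  have h1 : Real.exp (-b) ≤ 2⁻¹ :=
    (exp_neg_le_inv (by linarith)).trans (inv_anti₀ two_pos (hL.trans hb))
  have h2 : L / 2 ≤ a * (1 - Real.exp (-b)) := by nlinarith
  refine (exp_neg_le_inv (by linarith)).trans ?_
  rw [← inv_div L 2]
  exact inv_anti₀ (by linarith) h2

namespace Model

variable {K : ℕ} {X : Type*} {Y : Fin K → Type*} {Z S T U : Type*} {V : Fin K → Type*}
  [Fintype X] [∀ k, Fintype (Y k)] [Fintype Z] [Fintype S] [Fintype T] [Fintype U]
  [∀ k, Fintype (V k)]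

/-- `I(Y_k; Z)`. -/
noncomputable def infoYZ (P : Model K X Y Z S T U V) (k : Fin K) : ℝ :=
  mutualInfo P.srcLaw (fun ω => ω.2.1 k) (fun ω => ω.2.2)

theorem infoYZ_eq (P : Model K X Y Z S T U V) (k : Fin K) : P.infoYZ k =
    entropy (law P.srcLaw fun ω => ω.2.1 k) + entropy (law P.srcLaw fun ω => ω.2.2) -
      entropy (law P.srcLaw fun ω => (ω.2.1 k, ω.2.2)) :=
  mutualInfo_eq_entropy P.srcLaw_mem.1 _ _

/-- Uniform covering and packing bounds for small typicality parameters. -/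
theorem exists_covering_packing (P : Model K X Y Z S T U V) {γ : ℝ} (hγ : 0 < γ) :
    ∃ Δ : ℝ, 0 < Δ ∧ ∀ δ δ' δ'' δ₁ δ₂ : ℝ, 0 < δ → δ < Δ → 0 < δ' → δ' < Δ → 0 < δ'' → δ'' < Δ →
      δ₁ < δ → δ₁ < δ' → δ₂ < δ → δ₂ < δ' →
      (∀ᶠ n : ℕ in Filter.atTop, ∀ x ∈ typicalSet δ₁ n (law P.pXY Prod.fst),
        (2 : ℝ) ^ (-((n : ℝ) * (P.infoXZ + γ))) * (P.typZ δ n).card ≤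
          probOf (fun _ => 1) fun z => z ∈ P.typZ δ n ∧ zipWord x z ∈ P.typXZ δ' n) ∧
      (∀ᶠ m : ℕ in Filter.atTop, ∀ s ∈ P.typS δ₂ m,
        (2 : ℝ) ^ (-((m : ℝ) * (P.infoST + γ))) * (P.typT δ m).card ≤
          probOf (fun _ => 1) fun t => t ∈ P.typT δ m ∧ zipWord s t ∈ P.typST δ' m) ∧
      (∀ᶠ n : ℕ in Filter.atTop, ∀ k (y : Fin n → Y k),
        probOf (fun _ => 1) (fun z => z ∈ P.typZ δ n ∧ zipWord y z ∈ P.typYZ k δ'' n) ≤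
          (2 : ℝ) ^ (-((n : ℝ) * (P.infoYZ k - γ))) * (P.typZ δ n).card) ∧
      (∀ᶠ m : ℕ in Filter.atTop, ∀ k (v : Fin m → V k),
        probOf (fun _ => 1) (fun t => t ∈ P.typT δ m ∧ zipWord v t ∈ P.typVT k δ'' m) ≤
          (2 : ℝ) ^ (-((m : ℝ) * (P.infoTV k - γ))) * (P.typT δ m).card) := by
  have hXZ := law_mem_stdSimplex P.srcLaw_mem fun ω => (ω.1, ω.2.2)
  have hST := law_mem_stdSimplex P.chLaw_mem fun ω => (ω.1, ω.2.1)
  have hYZ := fun k => law_mem_stdSimplex P.srcLaw_mem fun ω => (ω.2.1 k, ω.2.2)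
  have hVT := fun k => law_mem_stdSimplex P.chLaw_mem fun ω => (ω.2.2.2 k, ω.2.1)
  obtain ⟨Δ₁, hΔ₁, h₁⟩ := exists_pos_forall_mul_add_mul_lt
    (entropy (law P.srcLaw fun ω => ω.2.2))
    (entropy (law P.srcLaw fun ω => (ω.1, ω.2.2)) - entropy (law P.srcLaw fun ω => ω.1)) hγ
  obtain ⟨Δ₂, hΔ₂, h₂⟩ := exists_pos_forall_mul_add_mul_lt
    (entropy (law P.chLaw fun ω => ω.2.1))
    (entropy (law P.chLaw fun ω => (ω.1, ω.2.1)) - entropy (law P.chLaw fun ω => ω.1)) hγ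
  choose Δ₃ hΔ₃ h₃ using fun k => exists_pos_forall_mul_add_mul_lt
    (entropy (law P.srcLaw fun ω => ω.2.2))
    (entropy (law P.srcLaw fun ω => (ω.2.1 k, ω.2.2)) - entropy (law P.srcLaw fun ω => ω.2.1 k)) hγ
  choose Δ₄ hΔ₄ h₄ using fun k => exists_pos_forall_mul_add_mul_lt
    (entropy (law P.chLaw fun ω => ω.2.1))
    (entropy (law P.chLaw fun ω => (ω.2.2.2 k, ω.2.1)) - entropy (law P.chLaw fun ω => ω.2.2.2 k)) hγ
  obtain ⟨d₃, hd₃, hd₃le⟩ := exists_pos_forall_le hΔ₃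
  obtain ⟨d₄, hd₄, hd₄le⟩ := exists_pos_forall_le hΔ₄
  refine ⟨min (min Δ₁ Δ₂) (min d₃ d₄), by positivity,
    fun δ δ' δ'' δ₁ δ₂ hδ hδΔ hδ' hδ'Δ hδ'' hδ''Δ h1 h2 h3 h4 => ⟨?_, ?_, ?_, ?_⟩⟩
  all_goals simp only [lt_min_iff] at hδΔ hδ'Δ hδ''Δ
  · have h := eventually_covering_le_count hXZ (δ := δ) (δ₁ := δ₁) (δ₂ := δ') (γ := γ) h1 h2
    simp only [law_law] at h
    have h := h (h₁ _ _ hδ hδΔ.1.1 hδ' hδ'Δ.1.1)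
    rw [← P.infoXZ_eq, P.law_srcLaw_x] at h
    exact h
  · have h := eventually_covering_le_count hST (δ := δ) (δ₁ := δ₂) (δ₂ := δ') (γ := γ) h3 h4
    simp only [law_law] at h
    have h := h (h₂ _ _ hδ hδΔ.1.2 hδ' hδ'Δ.1.2)
    rw [← P.infoST_eq, P.law_chLaw_s] at h
    exact h
  · refine Filter.eventually_all.2 fun k => ?_
    have h := eventually_count_le_packing (hYZ k) (δ₂ := δ'') (γ := γ) hδ
    simp only [law_law] at h
    have h := h (h₃ k _ _ hδ (hδΔ.2.1.trans_le (hd₃le k)) hδ'' (hδ''Δ.2.1.trans_le (hd₃le k)))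
    rw [← P.infoYZ_eq] at h
    exact h
  · refine Filter.eventually_all.2 fun k => ?_
    have h := eventually_count_le_packing (hVT k) (δ₂ := δ'') (γ := γ) hδ
    simp only [law_law] at h
    have h := h (h₄ k _ _ hδ (hδΔ.2.2.trans_le (hd₄le k)) hδ'' (hδ''Δ.2.2.trans_le (hd₄le k)))
    rw [← P.infoTV_eq] at h
    exact h

/-- Averaging a bound that holds for every typical source word and every typical CSI word. -/
theorem le_schemeSuccess (P : Model K X Y Z S T U V) {n m M M' : ℕ} [NeZero M] [NeZero M']
    {W : X → (∀ k, Y k) → ℝ} (hW : ∀ x, W x ∈ stdSimplex ℝ (∀ k, Y k))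
    (hPW : ∀ x y, P.pXY (x, y) = law P.pXY Prod.fst x * W x y)
    {δ δ' δ'' η δ₁ ε₀ τ : ℝ} (hτ : τ ≤ 1)
    (hcard : 0 < (codebooks P δ n m M M').card)
    (hx : probOf (fun x : Fin n → X => ∏ l, law P.pXY Prod.fst (x l))
      (fun x => x ∉ typicalSet δ₁ n (law P.pXY Prod.fst)) ≤ ε₀)
    (hcode : ∀ x ∈ typicalSet δ₁ n (law P.pXY Prod.fst), ∀ s ∈ P.typS η m,
      (1 - τ) * (codebooks P δ n m M M').card ≤ ∑ c ∈ codebooks P δ n m M M',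
        ∑ y : Fin n → ∀ k, Y k, (∏ l, W (x l) (y l)) * channelSuccess P δ' δ'' c.1 c.2 x y s)
    {q : (Fin n → X) → (Fin m → S) → ℝ} (hq : ∀ x, q x ∈ stdSimplex ℝ (Fin m → S))
    (hqs : ∀ x s, s ∉ P.typS η m → q x s = 0) :
    (1 - τ) * (1 - ε₀) ≤ schemeSuccess P δ δ' δ'' n m M M' q := by
  have hpX := law_mem_stdSimplex P.pXY_mem (Prod.fst (α := X))
  set pX := law P.pXY (Prod.fst (α := X))
  have hpXn := prod_words_mem_stdSimplex fun _ : Fin n => hpX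
  set F : (Fin n → X) → (Fin m → S) → ℝ := fun x s => ∑ c ∈ codebooks P δ n m M M',
    ∑ y : Fin n → ∀ k, Y k, (∏ l, W (x l) (y l)) * channelSuccess P δ' δ'' c.1 c.2 x y s with hF
  have hF0 : ∀ x s, 0 ≤ F x s := by
    intro x s
    refine Finset.sum_nonneg fun c _ => Finset.sum_nonneg fun y _ =>
      mul_nonneg (Finset.prod_nonneg fun l _ => (hW _).1 _) ?_
    unfold channelSuccess
    split
    · exact le_rfl
    · refine Finset.sum_nonneg fun u _ => Finset.sum_nonneg fun v _ => mul_nonneg (mul_nonneg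
        (Finset.prod_nonneg fun l _ => (P.pU_mem _ _).1 _)
        (Finset.prod_nonneg fun l _ => (P.pV_mem _ _).1 _)) ?_
      split_ifs <;> norm_num
  -- Writing the joint law as `pX` times `W` moves the averages over side information and codebooks
  -- inside, for fixed source word and CSI.
  have hsum : ∑ c ∈ codebooks P δ n m M M', codeSuccess P δ' δ'' q c.1 c.2 =
      ∑ x, (∏ l, pX (x l)) * ∑ s, q x s * F x s := by
    simp only [codeSuccess, hF]
    rw [Finset.sum_comm]
    refine Finset.sum_congr rfl fun x _ => ?_
    simp only [Finset.mul_sum]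
    rw [Finset.sum_comm' (t' := Finset.univ) (s' := fun _ => codebooks P δ n m M M') (by simp)]
    rw [Finset.sum_congr rfl fun y _ => Finset.sum_comm, Finset.sum_comm]
    refine Finset.sum_congr rfl fun s _ => ?_
    rw [Finset.sum_comm]
    refine Finset.sum_congr rfl fun c _ => Finset.sum_congr rfl fun y _ => ?_
    simp only [hPW, Finset.prod_mul_distrib]
    ring
  have hcard' : (0 : ℝ) < (codebooks P δ n m M M').card := by exact_mod_cast hcard
  rw [schemeSuccess, le_div_iff₀ hcard', hsum]
  set N : ℝ := ((codebooks P δ n m M M').card : ℝ)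
  have hterm : ∀ x, (if x ∈ typicalSet δ₁ n pX then (∏ l, pX (x l)) else 0) * ((1 - τ) * N) ≤
      (∏ l, pX (x l)) * ∑ s, q x s * F x s := by
    intro x
    split_ifs with hxt
    · refine mul_le_mul_of_nonneg_left ?_ (hpXn.1 x)
      calc (1 - τ) * N = ∑ s, q x s * ((1 - τ) * N) := by
            rw [← Finset.sum_mul, (hq x).2, one_mul]
        _ ≤ _ := Finset.sum_le_sum fun s _ => ?_
      -- The only use of the CSI law: it is a probability and vanishes off the typical set.
      by_cases hs : s ∈ P.typS η m
      · exact mul_le_mul_of_nonneg_left (hcode x hxt s hs) ((hq x).1 s)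
      · simp [hqs x s hs]
    · rw [zero_mul]
      exact mul_nonneg (hpXn.1 x) (Finset.sum_nonneg fun s _ => mul_nonneg ((hq x).1 s) (hF0 x s))
  refine le_trans ?_ (Finset.sum_le_sum fun x _ => hterm x)
  rw [← Finset.sum_mul, ← probOf_eq_sum_ite]
  have h1 := probOf_add_probOf_not (fun x : Fin n → X => ∏ l, pX (x l))
    fun x => x ∈ typicalSet δ₁ n pX
  rw [hpXn.2] at h1
  have h2 : 0 ≤ (1 - τ) * N := mul_nonneg (by linarith) hcard'.le
  nlinarith [mul_le_mul_of_nonneg_right (by linarith : 1 - ε₀ ≤ probOf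
    (fun x : Fin n → X => ∏ l, pX (x l)) fun x => x ∈ typicalSet δ₁ n pX) h2]

end Model

theorem two_rpow_neg_le_inv {x L : ℝ} (hL : 0 < L) (h : L ≤ (2 : ℝ) ^ x) :
    (2 : ℝ) ^ (-x) ≤ L⁻¹ := by
  rw [Real.rpow_neg two_pos.le]
  exact inv_anti₀ hL h

/-- The two codebook sizes cost 2γ each and the packing bounds γ/2 each, per letter of the
respective block. The constant 3 thus leaves γ/2 to spare. -/
theorem wrong_pair_exponent_le {n m κ γ a b c d : ℝ} (hn : 0 ≤ n) (hm : m = κ * n) (hγ : 0 ≤ γ)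
    (hκ : 0 ≤ κ) (h : 3 * (1 + κ) * γ ≤ κ * (d - b) - (a - c)) :
    n * (a + 2 * γ) + m * (b + 2 * γ) + (-(n * (c - γ / 2)) + -(m * (d - γ / 2))) ≤
      -(n * (γ / 2)) := by
  subst hm
  nlinarith [mul_le_mul_of_nonneg_left h hn, mul_nonneg hn (mul_nonneg hκ hγ)]

namespace Model

variable {K : ℕ} {X : Type*} {Y : Fin K → Type*} {Z S T U : Type*} {V : Fin K → Type*}
  [Fintype X] [∀ k, Fintype (Y k)] [Fintype Z] [Fintype S] [Fintype T] [Fintype U]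
  [∀ k, Fintype (V k)]

theorem codebooks_eq_codes (P : Model K X Y Z S T U V) (δ : ℝ) (n m M M' : ℕ) :
    codebooks P δ n m M M' = codes (P.typZ δ n) (P.typT δ m) M M' := rfl

/-- Needed because the success probability is normalized by the number of codebooks. -/
theorem eventually_codebooks_nonempty (P : Model K X Y Z S T U V) {δ : ℝ} (hδ : 0 < δ) :
    (∀ᶠ n : ℕ in Filter.atTop, (P.typZ δ n).Nonempty) ∧
      ∀ᶠ m : ℕ in Filter.atTop, (P.typT δ m).Nonempty := by
  constructor
  · filter_upwards [eventually_le_card_typicalSet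
      (law_mem_stdSimplex P.srcLaw_mem fun ω => ω.2.2) hδ] with n hn
    refine Finset.card_pos.1 ?_
    have : (0 : ℝ) < (P.typZ δ n).card := lt_of_lt_of_le (by positivity) hn
    exact_mod_cast this
  · filter_upwards [eventually_le_card_typicalSet
      (law_mem_stdSimplex P.chLaw_mem fun ω => ω.2.1) hδ] with n hn
    refine Finset.card_pos.1 ?_
    have : (0 : ℝ) < (P.typT δ n).card := lt_of_lt_of_le (by positivity) hn
    exact_mod_cast this

end Model

end CDSDPC

/-! ### The main theorem. -/

theorem mainTheorem10 {K : ℕ} {X : Type*} {Y : Fin K → Type*} {Z S T U : Type*}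
    {V : Fin K → Type*} [Fintype X] [∀ k, Fintype (Y k)] [Fintype Z] [Fintype S] [Fintype T]
    [Fintype U] [∀ k, Fintype (V k)]
    (P : CDSDPC.Model K X Y Z S T U V) (κ : ℚ) (hκ : 0 < κ)
    (hrate : ∀ k, P.infoXZgivenY k < (κ : ℝ) * (P.infoTV k - P.infoST)) :
    ∃ γ₀ : ℝ, 0 < γ₀ ∧ ∀ γ : ℝ, 0 < γ → γ < γ₀ →
    ∃ Δ : ℝ, 0 < Δ ∧ ∀ δ δ' δ'' η : ℝ, 0 < δ → δ < Δ → 0 < δ' → δ' < δ'' → δ'' < Δ →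
      0 < η → η < δ → η < δ' →
    ∀ ε : ℝ, 0 < ε → ∃ n₀ : ℕ, ∀ n m : ℕ, n₀ < n → (m : ℚ) = κ * n →
    ∀ (M M' : ℕ) [NeZero M] [NeZero M'],
      (2 : ℝ) ^ ((n : ℝ) * (P.infoXZ + γ)) ≤ M → (M : ℝ) ≤ 2 ^ ((n : ℝ) * (P.infoXZ + 2 * γ)) →
      (2 : ℝ) ^ ((m : ℝ) * (P.infoST + γ)) ≤ M' →
      (M' : ℝ) ≤ 2 ^ ((m : ℝ) * (P.infoST + 2 * γ)) →
    ∀ q : (Fin n → X) → (Fin m → S) → ℝ,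
      (∀ x, q x ∈ stdSimplex ℝ (Fin m → S)) → (∀ x s, s ∉ P.typS η m → q x s = 0) →
      1 - ε < CDSDPC.schemeSuccess P δ δ' δ'' n m M M' q := by
  have hκ' : (0 : ℝ) < κ := by exact_mod_cast hκ
  have hd : ∀ k, 0 < P.infoTV k - P.infoST := fun k =>
    pos_of_mul_pos_right ((P.infoXZgivenY_nonneg k).trans_lt (hrate k)) hκ'.le
  have hh : ∀ k, 0 < κ * (P.infoTV k - P.infoST) - (P.infoXZ - P.infoYZ k) := fun k =>
    sub_pos.2 ((P.infoXZgivenY_eq k).symm.trans_lt (hrate k))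
  -- The first bound serves wrong pairs in other rows, the second wrong pairs in the chosen row.
  obtain ⟨γ₀, hγ₀, hγ₀le⟩ := CDSDPC.exists_pos_forall_le
    (f := fun k => min ((κ * (P.infoTV k - P.infoST) - (P.infoXZ - P.infoYZ k)) / (3 * (1 + κ)))
      ((P.infoTV k - P.infoST) / 3))
    fun k => lt_min (div_pos (hh k) (by positivity)) (div_pos (hd k) (by norm_num))
  refine ⟨γ₀, hγ₀, fun γ hγ hγlt => ?_⟩
  have hγh : ∀ k, 3 * (1 + κ) * γ ≤
      κ * (P.infoTV k - P.infoST) - (P.infoXZ - P.infoYZ k) := by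
    intro k
    have := hγlt.le.trans ((hγ₀le k).trans (min_le_left _ _))
    rw [le_div_iff₀ (by positivity)] at this
    linarith
  have hγd : ∀ k, 3 * γ ≤ P.infoTV k - P.infoST := by
    intro k
    have := hγlt.le.trans ((hγ₀le k).trans (min_le_right _ _))
    linarith
  obtain ⟨Δ, hΔ, hcp⟩ := P.exists_covering_packing (half_pos hγ)
  refine ⟨Δ, hΔ, fun δ δ' δ'' η hδ hδΔ hδ' hδ'δ'' hδ''Δ hη hηδ hηδ' ε hε => ?_⟩
  have hmin : 0 < min δ δ' := lt_min hδ hδ'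
  -- Source words are taken typical with tolerance min δ δ' / 2, strictly below both covering
  -- tolerances; for the CSI, η already is.
  obtain ⟨hcovX, hcovS, hpackY, hpackV⟩ := hcp δ δ' δ'' (min δ δ' / 2) η hδ hδΔ hδ'
    (hδ'δ''.trans hδ''Δ) (hδ'.trans hδ'δ'') hδ''Δ ((half_lt_self hmin).trans_le (min_le_left _ _))
    ((half_lt_self hmin).trans_le (min_le_right _ _)) hηδ hηδ'
  obtain ⟨W, hW, hPW⟩ := CDSDPC.exists_kernel P.pXY_mem
  set c := min ε 1 with hc
  have hc0 : 0 < c := lt_min hε one_pos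
  have hc1 : c ≤ 1 := min_le_right _ _
  have hcε : c ≤ ε := min_le_left _ _
  -- Each error probability will be at most 1/L, except 2/L for covering. The total (2 + 4K)/L is
  -- then at most c/4.
  set L : ℝ := 16 * (K + 1) / c with hL
  have hK : (0 : ℝ) ≤ K := Nat.cast_nonneg K
  have hLpos : 0 < L := by positivity
  have hL2 : 2 ≤ L := by
    rw [hL, le_div_iff₀ hc0]
    linarith
  have hLK : (2 + 4 * K) / L ≤ c / 4 := by
    rw [hL, div_div_eq_mul_div, div_le_iff₀ (by positivity)]
    nlinarith
  obtain ⟨hneZ, hneT⟩ := P.eventually_codebooks_nonempty hδ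
  have hn_ev := (((hcovX.and hpackY).and hneZ).and
    (P.eventually_probOf_not_typYZ_le hW hPW hδ'δ'' (inv_pos.2 hLpos))).and
    ((CDSDPC.eventually_probOf_not_typical_le
      (CDSDPC.law_mem_stdSimplex P.pXY_mem (Prod.fst (α := X))) (half_pos hmin)
      (by positivity : 0 < c / 4)).and (CDSDPC.eventually_le_rpow L (half_pos hγ)))
  have hm_ev := CDSDPC.eventually_forall_eq_mul hκ ((((hcovS.and hpackV).and hneT).and
    (P.eventually_probOf_not_typVT_le hδ'δ'' (inv_pos.2 hLpos))).and
    (CDSDPC.eventually_le_rpow L (half_pos hγ)))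
  obtain ⟨n₀, hn₀⟩ := Filter.eventually_atTop.1 (hn_ev.and hm_ev)
  refine ⟨n₀, fun n m hn hmn M M' _ _ hM hM2 hM' hM'2 q hq hqs => ?_⟩
  obtain ⟨⟨⟨⟨⟨hcovX, hpackY⟩, hneZ⟩, hAYZ⟩, hXtyp, hLn⟩, hm⟩ := hn₀ n hn.le
  obtain ⟨⟨⟨⟨hcovS, hpackV⟩, hneT⟩, hBVT⟩, hLm⟩ := hm m hmn
  have hmn' : (m : ℝ) = κ * n := by exact_mod_cast congrArg (Rat.cast : ℚ → ℝ) hmn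
  -- Codebook rates exceed the information by γ and the covering bound loses γ/2, so the expected
  -- number of acceptable words still grows like 2^(lγ/2).
  have hlow : ∀ (l N : ℕ) (I : ℝ), L ≤ (2 : ℝ) ^ ((l : ℝ) * (γ / 2)) →
      (2 : ℝ) ^ ((l : ℝ) * (I + γ)) ≤ N → L ≤ N * (2 : ℝ) ^ (-((l : ℝ) * (I + γ / 2))) := by
    intro l N I h1 h2
    refine h1.trans ((le_of_eq ?_).trans (mul_le_mul_of_nonneg_right h2 (by positivity)))
    rw [← Real.rpow_add two_pos]
    congr 1
    ring
  have hMM' : ∀ k, (M : ℝ) * M' * ((2 : ℝ) ^ (-((n : ℝ) * (P.infoYZ k - γ / 2))) *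
      (2 : ℝ) ^ (-((m : ℝ) * (P.infoTV k - γ / 2)))) ≤ L⁻¹ := by
    intro k
    refine le_trans ?_ (CDSDPC.two_rpow_neg_le_inv hLpos hLn)
    refine (mul_le_mul_of_nonneg_right (mul_le_mul hM2 hM'2 (Nat.cast_nonneg _) (by positivity))
      (by positivity)).trans ?_
    rw [← Real.rpow_add two_pos, ← Real.rpow_add two_pos, ← Real.rpow_add two_pos]
    exact Real.rpow_le_rpow_of_exponent_le one_le_two
      (CDSDPC.wrong_pair_exponent_le (Nat.cast_nonneg n) hmn' hγ.le hκ'.le (hγh k))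
  have hM'σ : ∀ k, (M' : ℝ) * (2 : ℝ) ^ (-((m : ℝ) * (P.infoTV k - γ / 2))) ≤ L⁻¹ := by
    intro k
    refine le_trans ?_ (CDSDPC.two_rpow_neg_le_inv hLpos hLm)
    refine (mul_le_mul_of_nonneg_right hM'2 (by positivity)).trans ?_
    rw [← Real.rpow_add two_pos]
    refine Real.rpow_le_rpow_of_exponent_le one_le_two ?_
    nlinarith [mul_le_mul_of_nonneg_left (hγd k) (Nat.cast_nonneg (α := ℝ) m)]
  refine lt_of_lt_of_le ?_ (P.le_schemeSuccess hW hPW (δ' := δ') (δ'' := δ'') (τ := c / 4)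
    (by linarith) ?_ hXtyp ?_ hq hqs)
  -- (1 - c/4)² ≥ 1 - c/2 > 1 - c ≥ 1 - ε.
  · nlinarith [sq_nonneg c]
  · refine Finset.card_pos.2 (Finset.Nonempty.product ?_ ?_)
    · exact Fintype.piFinset_nonempty.2 fun _ => hneZ
    · exact Fintype.piFinset_nonempty.2 fun _ => Fintype.piFinset_nonempty.2 fun _ => hneT
  · intro x hx s hs
    simp_rw [P.sum_prod_mul_channelSuccess W δ' δ'', P.codebooks_eq_codes]
    refine le_trans ?_ (CDSDPC.le_sum_pairSuccess
      (a := fun z => CDSDPC.zipWord x z ∈ P.typXZ δ' n)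
      (b := fun t => CDSDPC.zipWord s t ∈ P.typST δ' m)
      (A := fun k (y : Fin n → ∀ k, Y k) z =>
        CDSDPC.zipWord (fun l => y l k) z ∈ P.typYZ k δ'' n)
      (B := fun k (v : Fin m → ∀ k, V k) t =>
        CDSDPC.zipWord (fun l => v l k) t ∈ P.typVT k δ'' m)
      (wy := fun y => ∏ l, W (x l) (y l)) (wv := fun t v => ∏ l, P.chan (s l, t l) (v l))
      (S := P.typZ δ n) (S' := P.typT δ m)
      (ρ := fun k => (2 : ℝ) ^ (-((n : ℝ) * (P.infoYZ k - γ / 2))))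
      (σ := fun k => (2 : ℝ) ^ (-((m : ℝ) * (P.infoTV k - γ / 2))))
      (π := (2 : ℝ) ^ (-((n : ℝ) * (P.infoXZ + γ / 2))))
      (π' := (2 : ℝ) ^ (-((m : ℝ) * (P.infoST + γ / 2))))
      (CDSDPC.prod_words_mem_stdSimplex fun l => hW (x l))
      (fun t => CDSDPC.prod_words_mem_stdSimplex fun l => P.chan_mem (s l, t l))
      (inv_pos.2 hLpos).le (fun k => by positivity) (fun k => by positivity) (by positivity)
      (fun z hz k => hAYZ x z hz k) (fun t ht k => hBVT s t ht k)
      (fun k y => hpackY k fun l => y l k) (fun k v => hpackV k fun l => v l k)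
      (hcovX x hx) (hcovS s hs))
    refine mul_le_mul_of_nonneg_right (sub_le_sub_left ?_ 1) (Nat.cast_nonneg _)
    rw [← mul_assoc]
    refine (add_le_add (CDSDPC.exp_neg_covering_le hL2 (hlow n M _ hLn hM) (hlow m M' _ hLm hM'))
      (Finset.sum_le_sum fun k _ => add_le_add_right (add_le_add (hMM' k) (hM'σ k)) _)).trans ?_
    refine le_trans (le_of_eq ?_) hLK
    simp only [Finset.sum_const, Finset.card_univ, Fintype.card_fin, nsmul_eq_mul]
    field_simp
    ring
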